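/- Let $r\ge 2$ be an integer, $q=e^{\pi i/r}$, $q^x=e^{\pi i x/r}$, $\{x\}=q^x-q^{-x}$, $[x]=\{x\}/\{1\}$. Let $\overline U$ be the unrolled restricted quantum group of $\mathfrak{sl}_2$: the complex Hopf algebra with generators $E,F,H,K^{\pm1}$ and relations $KK^{-1}=K^{-1}K=1$, $KEK^{-1}=q^2E$, $KFK^{-1}=q^{-2}F$, $[E,F]=\frac{K-K^{-1}}{q-q^{-1}}$, $HK=KH$, $[H,E]=2E$, $[H,F]=-2F$, $E^r=F^r=0$, coproduct $\Delta E=1\otimes E+E\otimes K$, $\Delta F=K^{-1}\otimes F+F\otimes 1$, $\Delta K=K\otimes K$, $\Delta H=H\otimes 1+1\otimes H$, and antipode $S(E)=-EK^{-1}$, $S(F)=-KF$, $S(K)=K^{-1}$, $S(H)=-H$. Let $\mathscr C$ be the category of finite-dimensional weight modules ($H$ acts diagonalizably and $K=q^H$), with the tensor product and duals given by this Hopf structure, left coevaluations $\mathrm{coev}_V:\mathbb C\to V\otimes V^*$, $1\mapsto\sum v_i\otimes v_i^*$, and right evaluations $\mathrm{ev}_V:V\otimes V^*\to\mathbb C$,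 $v\otimes\varphi\mapsto\varphi(K^{1-r}v)$. For $f\in\mathrm{End}_{\mathscr C}(U\otimes W)$ put $\mathrm{ptr}_R(f)=(\mathrm{Id}_U\otimes\mathrm{ev}_W)(f\otimes\mathrm{Id}_{W^*})(\mathrm{Id}_U\otimes\mathrm{coev}_W)\in\mathrm{End}_{\mathscr C}(U)$. Let $V_\alpha$ ($\alpha\in\mathbb C$) be the $r$-dimensional module with basis $v_0,\dots,v_{r-1}$ and $Hv_i=(\alpha+r-1-2i)v_i$, $Ev_i=[i][i-\alpha]v_{i-1}$, $Fv_i=v_{i+1}$ ($v_r=0$); let $S_n$ ($0\le n\le r-2$) be the simple module of highest weight $n$ and dimension $n+1$, $P_n$ its projective cover in $\mathscr C$, and $\mathbb C^H_{ar}$ ($a\in\mathbb Z$) the one-dimensional module on which $E=F=0$ and $H=ar$. Let $\mathscr D$ be the full subcategory of $\mathscr C$ whose objects are the finite direct sums of retracts of tensor products of the modules $V_\alpha$ ($\alpha\in(\mathbb R\setminus\mathbb Z)\cup r\mathbb Z$), $S_n$, $P_n$ ($0\le n\le r-2$), $\mathbb C^H_{ar}$ ($a\in\mathbb Z$) and their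 duals. Let $\dagger$ be the antilinear antiautomorphism of $\overline U$ with $E^\dagger=F$, $F^\dagger=E$, $K^\dagger=K^{-1}$, $H^\dagger=H$. A Hermitian structure on $V\in\mathscr C$ is a non-degenerate Hermitian form $(\cdot,\cdot)_V$, antilinear in the first variable, with $(x^\dagger v,w)_V=(v,xw)_V$ for all $x\in\overline U$. Let $\mathscr D^\dagger$ be the category of objects of $\mathscr D$ equipped with a Hermitian structure, with all $\overline U$-linear maps as morphisms. For $f:V\to W$ in $\mathscr D^\dagger$ let $f^\dagger:W\to V$ be the adjoint: $(w,f(v))_W=(f^\dagger(w),v)_V$. Let $d_0\in\mathbb R$ and let $\mathsf t=(\mathsf t_V)$ be the modified trace on the projective objects of $\mathscr C$ normalized by $d_0$: a family of linear maps $\mathsf t_V:\mathrm{End}_{\mathscr C}(V)\to\mathbb C$, $V$ projective in $\mathscr C$, with $\mathsf t_{U\otimes W}(f)=\mathsf t_U(\mathrm{ptr}_R(f))$ for $U$ projective, $W\in\mathscr C$ and $f\in\mathrm{End}_{\mathscr C}(U\otimes W)$, with $\mathsf t_V(gf)=\mathsf t_U(fg)$ for $f:V\to U$, $g:U\to V$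 and $U,V$ projective, and with $\mathsf t_{V_\alpha}(\mathrm{Id})=d_0\{\alpha\}/\{r\alpha\}$ for all $\alpha\in\mathbb C\setminus\mathbb Z$. (1) For every $W\in\mathscr D^\dagger$ that is projective in $\mathscr C$ and every $f\in\mathrm{End}_{\mathscr C}(W)$, $\mathsf t_W(f^\dagger)=\overline{\mathsf t_W(f)}$. (2) For $V,W\in\mathscr D^\dagger$ with $V$ or $W$ projective in $\mathscr C$, consider on $\mathrm{Hom}_{\mathscr C}(V,W)$ the pairing $\langle f,g\rangle=\mathsf t_V(f^\dagger g)$ if $V$ is projective, and $\langle f,g\rangle=\mathsf t_W(gf^\dagger)$ if $W$ is projective; the two expressions agree if both $V$ and $W$ are projective. This pairing is Hermitian (linear in $g$, and $\langle f,g\rangle=\overline{\langle g,f\rangle}$), and if $d_0\ne0$ it is non-degenerate: if $\langle f,g\rangle=0$ for all $g$, then $f=0$. -/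

import Mathlib

open CategoryTheory
open scoped TensorProduct ComplexConjugate

namespace UnrolledQuantum

noncomputable section

/-- `q ^ x = exp (π i x / r)`, where `q = exp (π i / r)`. -/
def qpow (r : ℕ) (x : ℂ) : ℂ := Complex.exp (Real.pi * Complex.I * x / r)

/-- `{x} = q ^ x - q ^ (-x)`. -/
def qn (r : ℕ) (x : ℂ) : ℂ := qpow r x - qpow r (-x)

/-- `[x] = {x} / {1}`. -/
def qN (r : ℕ) (x : ℂ) : ℂ := qn r x / qn r 1

/-- A finite dimensional weight module over the (restricted) unrolled quantum group of `sl(2)` at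
`q = exp (π i / r)`: the algebra has generators `E, F, H, K, K⁻¹` and the relations listed here, so
a module is a vector space with five operators that satisfy the relations; it is a weight module if
it is the sum of its weight spaces (eigenspaces of `H`) and `K = q ^ H`. -/
structure WeightModule (r : ℕ) where
  carrier : Type
  [addCommGroup : AddCommGroup carrier]
  [module : Module ℂ carrier]
  [finiteDimensional : FiniteDimensional ℂ carrier]
  E : Module.End ℂ carrier
  F : Module.End ℂ carrier
  H : Module.End ℂ carrier
  K : Module.End ℂ carrier
  Kinv : Module.End ℂ carrier
  K_mul_Kinv : K * Kinv = 1
  Kinv_mul_K : Kinv * K = 1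
  K_E : K * E * Kinv = qpow r 2 • E
  K_F : K * F * Kinv = qpow r (-2) • F
  E_F : E * F - F * E = (qn r 1)⁻¹ • (K - Kinv)
  H_K : H * K = K * H
  H_E : H * E - E * H = (2 : ℂ) • E
  H_F : H * F - F * H = (-2 : ℂ) • F
  E_pow : E ^ r = 0
  F_pow : F ^ r = 0
  iSup_weightSpace : ⨆ l : ℂ, Module.End.eigenspace H l = ⊤
  K_weight : ∀ (l : ℂ) (v : carrier), H v = l • v → K v = qpow r l • v

namespace WeightModule

instance (r : ℕ) : CoeSort (WeightModule r) Type := ⟨WeightModule.carrier⟩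

attribute [instance] addCommGroup module finiteDimensional

end WeightModule

/-! ### Elementary facts about `q ^ x` and weight vectors -/

lemma qpow_add (r : ℕ) (x y : ℂ) : qpow r (x + y) = qpow r x * qpow r y := by
  rw [qpow, qpow, qpow, ← Complex.exp_add]; congr 1; ring

lemma qpow_zero (r : ℕ) : qpow r 0 = 1 := by simp [qpow]

lemma qpow_mul_neg (r : ℕ) (x : ℂ) : qpow r x * qpow r (-x) = 1 := by
  rw [← qpow_add, add_neg_cancel, qpow_zero]

lemma qpow_neg_mul (r : ℕ) (x : ℂ) : qpow r (-x) * qpow r x = 1 := by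
  rw [mul_comm, qpow_mul_neg]

lemma qpow_ne_zero (r : ℕ) (x : ℂ) : qpow r x ≠ 0 := Complex.exp_ne_zero _

lemma qpow_nat_mul (r : ℕ) (n : ℕ) (x : ℂ) : qpow r (n * x) = qpow r x ^ n := by
  rw [qpow, qpow, ← Complex.exp_nat_mul]; congr 1; ring

lemma qpow_self (r : ℕ) (hr : r ≠ 0) : qpow r r = -1 := by
  have : (r : ℂ) ≠ 0 := by exact_mod_cast hr
  rw [qpow, mul_div_assoc, div_self this, mul_one, Complex.exp_pi_mul_I]

lemma qn_self (r : ℕ) (hr : r ≠ 0) : qn r r = 0 := by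
  have h := qpow_mul_neg r r
  rw [qpow_self r hr] at h
  rw [qn, qpow_self r hr]
  linear_combination h

lemma qn_zero (r : ℕ) : qn r 0 = 0 := by simp [qn]

lemma qn_int_mul (r : ℕ) (hr : r ≠ 0) (a : ℤ) : qn r (a * r) = 0 := by
  have : (r : ℂ) ≠ 0 := by exact_mod_cast hr
  rw [qn, sub_eq_zero, qpow, qpow, Complex.exp_eq_exp_iff_exists_int]
  exact ⟨a, by field_simp; ring⟩

lemma qn_mul_identity (r : ℕ) (n m : ℂ) :
    qn r (n + 1) * qn r (m - n) - qn r n * qn r (m + 1 - n) = qn r 1 * qn r (m - 2 * n) := by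
  simp only [qn, sub_mul, mul_sub, ← qpow_add]
  ring_nf

lemma qN_mul_identity (r : ℕ) (n m : ℂ) :
    qN r (n + 1) * qN r (m - n) - qN r n * qN r (m + 1 - n) = (qn r 1)⁻¹ * qn r (m - 2 * n) := by
  simp only [qN]
  have := qn_mul_identity r n m
  by_cases h : qn r 1 = 0
  · simp [h]
  · rw [div_mul_div_comm, div_mul_div_comm, ← sub_div, this, mul_div_mul_left _ _ h, div_eq_inv_mul]

section Basis

variable {r : ℕ} {V : Type} [AddCommGroup V] [Module ℂ V]

lemma weight_of_basis {ι : Type} (b : Module.Basis ι ℂ V) (μ : ι → ℂ)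
    (H K : Module.End ℂ V) (φ : ℂ → ℂ) (hH : ∀ i, H (b i) = μ i • b i)
    (hK : ∀ i, K (b i) = φ (μ i) • b i) (l : ℂ) (v : V) (hv : H v = l • v) :
    K v = φ l • v := by
  have hHr : ∀ w i, b.repr (H w) i = μ i * b.repr w i := by
    intro w i
    have : b.coord i ∘ₗ H = μ i • b.coord i := by
      refine b.ext fun j => ?_
      by_cases h : j = i
      · subst h; simp [hH]
      · simp [hH, h]
    simpa using LinearMap.congr_fun this w
  have hKr : ∀ w i, b.repr (K w) i = φ (μ i) * b.repr w i := by
    intro w i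
    have : b.coord i ∘ₗ K = φ (μ i) • b.coord i := by
      refine b.ext fun j => ?_
      by_cases h : j = i
      · subst h; simp [hK]
      · simp [hK, h]
    simpa using LinearMap.congr_fun this w
  apply b.repr.injective
  ext i
  have h1 := hHr v i
  rw [hv] at h1
  rw [hKr]
  simp only [map_smul, Finsupp.smul_apply, smul_eq_mul] at h1 ⊢
  rcases eq_or_ne (b.repr v i) 0 with h0 | h0
  · simp [h0]
  · rw [mul_right_cancel₀ h0 h1]

/-- Constructor of weight modules from a basis of weight vectors. -/
def ofBasis [FiniteDimensional ℂ V] {ι : Type} (b : Module.Basis ι ℂ V) (μ : ι → ℂ)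
    (E F H K Kinv : Module.End ℂ V)
    (hH : ∀ i, H (b i) = μ i • b i) (hK : ∀ i, K (b i) = qpow r (μ i) • b i)
    (hKinv : ∀ i, Kinv (b i) = qpow r (-μ i) • b i)
    (hHE : H * E - E * H = (2 : ℂ) • E) (hHF : H * F - F * H = (-2 : ℂ) • F)
    (hEF : E * F - F * E = (qn r 1)⁻¹ • (K - Kinv)) (hE : E ^ r = 0) (hF : F ^ r = 0) :
    WeightModule r where
  carrier := V
  E := E
  F := F
  H := H
  K := K
  Kinv := Kinv
  K_mul_Kinv := b.ext fun i => by
    simp [hK, hKinv, smul_smul, qpow_neg_mul]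
  Kinv_mul_K := b.ext fun i => by
    simp [hK, hKinv, smul_smul, qpow_mul_neg]
  K_E := b.ext fun i => by
    have h : H (E (b i)) = (2 + μ i) • E (b i) := by
      have := LinearMap.congr_fun hHE (b i)
      simp only [LinearMap.sub_apply, Module.End.mul_apply, hH, map_smul,
        LinearMap.smul_apply] at this
      rw [add_smul, ← this, sub_add_cancel]
    have := weight_of_basis b μ H K (qpow r) hH hK _ _ h
    simp only [Module.End.mul_apply, hKinv, map_smul, this, smul_smul, LinearMap.smul_apply]
    rw [← qpow_add]; congr 2; ring
  K_F := b.ext fun i => by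
    have h : H (F (b i)) = (-2 + μ i) • F (b i) := by
      have := LinearMap.congr_fun hHF (b i)
      simp only [LinearMap.sub_apply, Module.End.mul_apply, hH, map_smul,
        LinearMap.smul_apply] at this
      rw [add_smul, ← this, sub_add_cancel]
    have := weight_of_basis b μ H K (qpow r) hH hK _ _ h
    simp only [Module.End.mul_apply, hKinv, map_smul, this, smul_smul, LinearMap.smul_apply]
    rw [← qpow_add]; congr 2; ring
  E_F := hEF
  H_K := b.ext fun i => by simp [hH, hK, smul_smul, mul_comm]
  H_E := hHE
  H_F := hHF
  E_pow := hE
  F_pow := hF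
  iSup_weightSpace := by
    rw [eq_top_iff, ← b.span_eq, Submodule.span_le]
    rintro _ ⟨i, rfl⟩
    exact Submodule.mem_iSup_of_mem (μ i) (Module.End.mem_eigenspace_iff.mpr (hH i))
  K_weight := weight_of_basis b μ H K (qpow r) hH hK

end Basis

lemma exists_weightBasis {r : ℕ} (X : WeightModule r) :
    ∃ (ι : Type) (_ : Fintype ι) (_ : DecidableEq ι) (b : Module.Basis ι ℂ X) (μ : ι → ℂ),
      (∀ i, X.H (b i) = μ i • b i) ∧ (∀ i, X.K (b i) = qpow r (μ i) • b i) ∧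
      (∀ i, X.Kinv (b i) = qpow r (-μ i) • b i) := by
  classical
  let s : Set X := {v | ∃ l : ℂ, X.H v = l • v}
  have hs : ⊤ ≤ Submodule.span ℂ s := by
    rw [← X.iSup_weightSpace, iSup_le_iff]
    intro l v hv
    exact Submodule.subset_span ⟨l, Module.End.mem_eigenspace_iff.mp hv⟩
  let b := Module.Basis.ofSpan hs
  have hb : ∀ i, ∃ l : ℂ, X.H (b i) = l • b i := fun i =>
    Module.Basis.ofSpan_subset hs ⟨i, rfl⟩
  choose μ hμ using hb
  have hK : ∀ i, X.K (b i) = qpow r (μ i) • b i := fun i => X.K_weight _ _ (hμ i)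
  refine ⟨_, Module.Finite.finite_basis b |> (fun h => @Fintype.ofFinite _ h), inferInstance,
    b, μ, hμ, hK, fun i => ?_⟩
  have h := LinearMap.congr_fun X.Kinv_mul_K (b i)
  simp only [Module.End.mul_apply, hK, map_smul, Module.End.one_apply] at h
  calc X.Kinv (b i) = (qpow r (-μ i) * qpow r (μ i)) • X.Kinv (b i) := by
        rw [qpow_neg_mul, one_smul]
    _ = _ := by rw [mul_smul, h]

/-! ### Highest weight modules, the trivial module -/

section HighestWeight

variable (N : ℕ)

/-- The `n`-th standard basis vector of `ℂ ^ N` (and `0` for `n ≥ N`). -/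
def stdVec (n : ℕ) : Fin N → ℂ := if h : n < N then Pi.single ⟨n, h⟩ 1 else 0

lemma stdVec_of_le {n : ℕ} (h : N ≤ n) : stdVec N n = 0 := dif_neg (not_lt.mpr h)

lemma basisFun_eq (i : Fin N) : Pi.basisFun ℂ (Fin N) i = stdVec N i := by
  simp [stdVec]

/-- The operator on `ℂ ^ N` with `v_n ↦ c n • v_{s n}`. -/
def stdOp (c : ℕ → ℂ) (s : ℕ → ℕ) : Module.End ℂ (Fin N → ℂ) :=
  (Pi.basisFun ℂ (Fin N)).constr ℂ fun i => c i • stdVec N (s i)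

lemma stdOp_basis (c : ℕ → ℂ) (s : ℕ → ℕ) (i : Fin N) :
    stdOp N c s (Pi.basisFun ℂ (Fin N) i) = c i • stdVec N (s i) := by
  rw [stdOp, Module.Basis.constr_basis]

lemma stdOp_stdVec (c : ℕ → ℂ) (s : ℕ → ℕ) (n : ℕ) (h : N ≤ n → c n • stdVec N (s n) = 0) :
    stdOp N c s (stdVec N n) = c n • stdVec N (s n) := by
  rcases lt_or_ge n N with hn | hn
  · rw [← basisFun_eq N ⟨n, hn⟩, stdOp_basis]
  · rw [h hn, stdVec_of_le N hn, map_zero]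

variable (r : ℕ) (m : ℂ)

/-- The `N`-dimensional highest weight module of highest weight `m`, with basis
`v_0, …, v_{N-1}` and
`H v_n = (m - 2 n) v_n`, `F v_n = v_{n+1}` (`v_N = 0`), `E v_n = [n] [m + 1 - n] v_{n-1}`;
it is a module if `[N] [m + 1 - N] = 0`. -/
def hwModule (hN : N ≤ r) (h0 : qN r N * qN r (m + 1 - N) = 0) : WeightModule r :=
  have hF : ∀ n, stdOp N (fun _ => 1) (· + 1) (stdVec N n) = stdVec N (n + 1) := fun n => by
    rw [stdOp_stdVec N _ _ n fun h => by rw [stdVec_of_le N (by omega), smul_zero], one_smul]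
  have hE : ∀ n, stdOp N (fun n => qN r n * qN r (m + 1 - n)) (· - 1) (stdVec N n) =
      (qN r n * qN r (m + 1 - n)) • stdVec N (n - 1) := fun n => by
    refine stdOp_stdVec N _ _ n fun h => ?_
    rcases eq_or_lt_of_le h with h | h
    · subst h; simp only [h0, zero_smul]
    · rw [stdVec_of_le N (by omega), smul_zero]
  have hH : ∀ n, stdOp N (fun n => m - 2 * n) id (stdVec N n) = (m - 2 * n) • stdVec N n :=
    fun n => stdOp_stdVec N _ _ n fun h => by simp [stdVec_of_le N h]
  have hK : ∀ n, stdOp N (fun n => qpow r (m - 2 * n)) id (stdVec N n) =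
      qpow r (m - 2 * n) • stdVec N n :=
    fun n => stdOp_stdVec N _ _ n fun h => by simp [stdVec_of_le N h]
  have hKinv : ∀ n, stdOp N (fun n => qpow r (-(m - 2 * n))) id (stdVec N n) =
      qpow r (-(m - 2 * n)) • stdVec N n :=
    fun n => stdOp_stdVec N _ _ n fun h => by simp [stdVec_of_le N h]
  ofBasis (V := Fin N → ℂ) (Pi.basisFun ℂ (Fin N)) (fun n => m - 2 * (n : ℕ))
    (stdOp N (fun n => qN r n * qN r (m + 1 - n)) (· - 1))
    (stdOp N (fun _ => 1) (· + 1))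
    (stdOp N (fun n => m - 2 * n) id)
    (stdOp N (fun n => qpow r (m - 2 * n)) id)
    (stdOp N (fun n => qpow r (-(m - 2 * n))) id)
    (fun i => by simp only [basisFun_eq, hH])
    (fun i => by simp only [basisFun_eq, hK])
    (fun i => by simp only [basisFun_eq, hKinv])
    ((Pi.basisFun ℂ (Fin N)).ext fun i => by
      obtain ⟨n, hn⟩ := i
      simp only [basisFun_eq, LinearMap.sub_apply, Module.End.mul_apply, hH, hE, map_smul,
        LinearMap.smul_apply, smul_smul, ← sub_smul]
      rcases n with _ | n
      · simp [qN, qn_zero]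
      · rw [Nat.add_sub_cancel]; congr 1; push_cast; ring)
    ((Pi.basisFun ℂ (Fin N)).ext fun i => by
      obtain ⟨n, hn⟩ := i
      simp only [basisFun_eq, LinearMap.sub_apply, Module.End.mul_apply, hH, hF, map_smul,
        LinearMap.smul_apply, ← sub_smul]
      congr 1; push_cast; ring)
    ((Pi.basisFun ℂ (Fin N)).ext fun i => by
      obtain ⟨n, hn⟩ := i
      simp only [basisFun_eq, LinearMap.sub_apply, Module.End.mul_apply, hK, hKinv, hF, hE,
        map_smul, LinearMap.smul_apply, ← sub_smul, smul_smul, Nat.add_sub_cancel]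
      rw [← qn, ← qN_mul_identity]
      rcases n with _ | n
      · simp [qN, qn_zero]
      · rw [Nat.add_sub_cancel, ← sub_smul]
        congr 1; push_cast; ring_nf)
    (by
      have key : ∀ k n, n < k →
          (stdOp N (fun n => qN r n * qN r (m + 1 - n)) (· - 1) ^ k) (stdVec N n) = 0 := by
        intro k
        induction k with
        | zero => intro n hn; omega
        | succ k ih =>
          intro n hn
          rw [pow_succ, Module.End.mul_apply, hE, map_smul]
          rcases n with _ | n
          · simp [qN, qn_zero]
          · rw [ih _ (by omega), smul_zero]
      refine (Pi.basisFun ℂ (Fin N)).ext fun i => ?_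
      rw [basisFun_eq, key _ _ (by omega), LinearMap.zero_apply])
    (by
      have key : ∀ k n,
          (stdOp N (fun _ => 1) (· + 1) ^ k) (stdVec N n) = stdVec N (n + k) := by
        intro k
        induction k with
        | zero => intro n; simp
        | succ k ih =>
          intro n
          rw [pow_succ, Module.End.mul_apply, hF, ih]; congr 1; omega
      refine (Pi.basisFun ℂ (Fin N)).ext fun i => ?_
      rw [basisFun_eq, key _ _, stdVec_of_le N (by omega), LinearMap.zero_apply])

lemma hwModule_E (hN : N ≤ r) (h0 : qN r N * qN r (m + 1 - N) = 0) :
    (hwModule N r m hN h0).E = stdOp N (fun n => qN r n * qN r (m + 1 - n)) (· - 1) := rfl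

end HighestWeight

/-- `V_α`: the `r`-dimensional highest weight module of highest weight `α + r - 1`. -/
def Valpha (r : ℕ) [r.AtLeastTwo] (α : ℂ) : WeightModule r :=
  hwModule r r (α + r - 1) le_rfl (by
    rw [qN, qn_self r (by have := Nat.AtLeastTwo.prop (n := r); omega), zero_div, zero_mul])

/-- `S_n`, `0 ≤ n ≤ r - 2`: the simple `(n + 1)`-dimensional module of highest weight `n`. -/
def Smod (r : ℕ) (n : ℕ) (hn : n + 2 ≤ r) : WeightModule r :=
  hwModule (n + 1) r n (by omega) (by
    push_cast
    rw [sub_self, qN, qN, qn_zero, zero_div, mul_zero])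

/-- `ℂ^H_{ar}`, `a ∈ ℤ`: the one-dimensional module on which `E = F = 0` and `H = a r`. -/
def CH (r : ℕ) [r.AtLeastTwo] (a : ℤ) : WeightModule r :=
  hwModule 1 r (a * r) (by have := Nat.AtLeastTwo.prop (n := r); omega) (by
    have h := Nat.AtLeastTwo.prop (n := r)
    rw [Nat.cast_one, add_sub_cancel_right, qN, qN, qn_int_mul r (by omega), zero_div, mul_zero])

/-- The trivial module `ℂ`. -/
@[reducible] def unitObj (r : ℕ) [r.AtLeastTwo] : WeightModule r where
  carrier := ℂ
  E := 0
  F := 0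
  H := 0
  K := 1
  Kinv := 1
  K_mul_Kinv := by simp
  Kinv_mul_K := by simp
  K_E := by simp
  K_F := by simp
  E_F := by simp
  H_K := by simp
  H_E := by simp
  H_F := by simp
  E_pow := zero_pow (by have := Nat.AtLeastTwo.prop (n := r); omega)
  F_pow := zero_pow (by have := Nat.AtLeastTwo.prop (n := r); omega)
  iSup_weightSpace := eq_top_iff.mpr fun v _ =>
    Submodule.mem_iSup_of_mem 0 (Module.End.mem_eigenspace_iff.mpr (by simp))
  K_weight := fun l v h => by
    rcases smul_eq_zero.mp h.symm with h | h
    · simp [h, qpow_zero]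
    · simp [h]

/-- In `V_α` the generator `E` acts by `v_i ↦ [i] [i - α] v_{i-1}`. -/
lemma Valpha_E (r : ℕ) [r.AtLeastTwo] (α : ℂ) :
    (Valpha r α).E = stdOp r (fun i => qN r i * qN r (i - α)) (· - 1) := by
  have hr : r ≠ 0 := by have := Nat.AtLeastTwo.prop (n := r); omega
  refine (hwModule_E r r (α + r - 1) _ _).trans ?_
  congr 1
  funext i
  have h : qn r (α + r - 1 + 1 - i) = qn r (i - α) := by
    have h1 : α + r - 1 + 1 - i = r + -(i - α) := by ring
    have h2 : -(r + -(i - α)) = (i - α) + -r := by ring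
    have h3 : qpow r (-(r : ℂ)) = -1 := by
      have h := qpow_mul_neg r r
      rw [qpow_self r hr] at h
      linear_combination -h
    rw [qn, h1, h2, qpow_add, qpow_add, qpow_self r hr, h3, qn]; ring
  simp only [qN, h]

/-! ### Dual modules -/

section CommutationRules

variable {r : ℕ} (X : WeightModule r)

lemma K_mul_E : X.K * X.E = qpow r 2 • (X.E * X.K) := by
  rw [← smul_mul_assoc, ← X.K_E, mul_assoc, X.Kinv_mul_K, mul_one]

lemma K_mul_F : X.K * X.F = qpow r (-2) • (X.F * X.K) := by
  rw [← smul_mul_assoc, ← X.K_F, mul_assoc, X.Kinv_mul_K, mul_one]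

lemma Kinv_mul_E : X.Kinv * X.E = qpow r (-2) • (X.E * X.Kinv) := by
  have h : X.E * X.Kinv = qpow r 2 • (X.Kinv * X.E) := by
    rw [← one_mul (X.E * X.Kinv), ← X.Kinv_mul_K, mul_assoc, ← mul_assoc X.K, X.K_E,
      mul_smul_comm]
  rw [h, smul_smul, qpow_neg_mul, one_smul]

lemma Kinv_mul_F : X.Kinv * X.F = qpow r 2 • (X.F * X.Kinv) := by
  have h : X.F * X.Kinv = qpow r (-2) • (X.Kinv * X.F) := by
    rw [← one_mul (X.F * X.Kinv), ← X.Kinv_mul_K, mul_assoc, ← mul_assoc X.K, X.K_F,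
      mul_smul_comm]
  rw [h, smul_smul, qpow_mul_neg, one_smul]

lemma H_mul_Kinv : X.H * X.Kinv = X.Kinv * X.H := by
  calc X.H * X.Kinv = X.Kinv * (X.K * X.H) * X.Kinv := by
        rw [← mul_assoc, X.Kinv_mul_K, one_mul]
    _ = X.Kinv * X.H := by
        rw [← X.H_K, ← mul_assoc, mul_assoc _ X.K, X.K_mul_Kinv, mul_one]

lemma E_mul_Kinv_pow (n : ℕ) : ∃ c : ℂ, (X.E * X.Kinv) ^ n = c • (X.E ^ n * X.Kinv ^ n) := by
  have key : ∀ n : ℕ, X.Kinv ^ n * X.E = qpow r (-2) ^ n • (X.E * X.Kinv ^ n) := by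
    intro n
    induction n with
    | zero => simp
    | succ n ih =>
      rw [pow_succ, mul_assoc, Kinv_mul_E, mul_smul_comm, ← mul_assoc, ih, smul_mul_assoc,
        smul_smul, mul_assoc, ← pow_succ, ← pow_succ']
  induction n with
  | zero => exact ⟨1, by simp⟩
  | succ n ih =>
    obtain ⟨c, hc⟩ := ih
    refine ⟨c * qpow r (-2) ^ n, ?_⟩
    rw [pow_succ, hc, smul_mul_assoc, mul_assoc, ← mul_assoc (X.Kinv ^ n), key, smul_mul_assoc,
      mul_smul_comm, smul_smul, pow_succ, pow_succ]
    simp only [mul_assoc]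

lemma K_mul_F_pow (n : ℕ) : ∃ c : ℂ, (X.K * X.F) ^ n = c • (X.F ^ n * X.K ^ n) := by
  have key : ∀ n : ℕ, X.K ^ n * X.F = qpow r (-2) ^ n • (X.F * X.K ^ n) := by
    intro n
    induction n with
    | zero => simp
    | succ n ih =>
      rw [pow_succ, mul_assoc, K_mul_F, mul_smul_comm, ← mul_assoc, ih, smul_mul_assoc,
        smul_smul, mul_assoc, ← pow_succ, ← pow_succ']
  induction n with
  | zero => exact ⟨1, by simp⟩
  | succ n ih =>
    obtain ⟨c, hc⟩ := ih
    refine ⟨c * qpow r (-2) ^ n * qpow r (-2), ?_⟩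
    rw [pow_succ, hc, K_mul_F, mul_smul_comm, smul_mul_assoc, mul_assoc,
      ← mul_assoc (X.K ^ n), key, smul_mul_assoc,
      mul_smul_comm, smul_smul, smul_smul, pow_succ, pow_succ]
    simp only [mul_assoc]
    congr 1; ring

end CommutationRules

section Dual

variable {V : Type} [AddCommGroup V] [Module ℂ V]

lemma dualMap_mul (A B : Module.End ℂ V) :
    (LinearMap.dualMap A : Module.End ℂ (Module.Dual ℂ V)) *
      (LinearMap.dualMap B : Module.End ℂ (Module.Dual ℂ V)) = LinearMap.dualMap (B * A) := rfl

lemma dualMap_sub (A B : Module.End ℂ V) :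
    (LinearMap.dualMap A : Module.End ℂ (Module.Dual ℂ V)) - LinearMap.dualMap B =
      LinearMap.dualMap (A - B) := by
  ext φ v; simp [LinearMap.dualMap_apply]

lemma dualMap_smul (c : ℂ) (A : Module.End ℂ V) :
    c • (LinearMap.dualMap A : Module.End ℂ (Module.Dual ℂ V)) = LinearMap.dualMap (c • A) := by
  ext φ v; simp [LinearMap.dualMap_apply]

lemma dualMap_pow (A : Module.End ℂ V) (n : ℕ) :
    (LinearMap.dualMap A : Module.End ℂ (Module.Dual ℂ V)) ^ n = LinearMap.dualMap (A ^ n) := by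
  induction n with
  | zero => rfl
  | succ n ih => rw [pow_succ, ih, dualMap_mul, ← pow_succ']

lemma dualMap_zero : (LinearMap.dualMap (0 : Module.End ℂ V)) = 0 := by
  ext φ v; simp [LinearMap.dualMap_apply]

end Dual

/-- The dual module `V* = Hom(V, ℂ)`, with `(x φ)(v) = φ (S(x) v)`, where `S` is the antipode:
`S(E) = -E K⁻¹`, `S(F) = -K F`, `S(H) = -H`, `S(K) = K⁻¹`. -/
@[reducible] def dualObj {r : ℕ} (X : WeightModule r) : WeightModule r where
  carrier := Module.Dual ℂ X
  E := LinearMap.dualMap (-(X.E * X.Kinv))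
  F := LinearMap.dualMap (-(X.K * X.F))
  H := LinearMap.dualMap (-X.H)
  K := LinearMap.dualMap X.Kinv
  Kinv := LinearMap.dualMap X.K
  K_mul_Kinv := by rw [dualMap_mul, X.K_mul_Kinv]; rfl
  Kinv_mul_K := by rw [dualMap_mul, X.Kinv_mul_K]; rfl
  K_E := by
    rw [dualMap_mul, dualMap_mul, dualMap_smul]
    congr 1
    rw [neg_mul, mul_neg, smul_neg, mul_assoc, ← mul_assoc, K_mul_E, smul_mul_assoc, mul_assoc,
      ← mul_assoc X.K, X.K_mul_Kinv, one_mul]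
  K_F := by
    rw [dualMap_mul, dualMap_mul, dualMap_smul]
    congr 1
    rw [neg_mul, mul_neg, smul_neg, mul_assoc, ← mul_assoc, ← mul_assoc, mul_assoc,
      ← mul_assoc, mul_assoc X.K X.K, K_mul_F, mul_smul_comm, smul_mul_assoc, mul_assoc X.K,
      mul_assoc X.F, X.K_mul_Kinv, mul_one, K_mul_F]
  E_F := by
    rw [dualMap_mul, dualMap_mul, dualMap_sub, dualMap_sub, dualMap_smul]
    congr 1
    have h1 : X.K * X.F * (X.E * X.Kinv) = X.F * X.E := by
      rw [mul_assoc, ← mul_assoc X.F, ← mul_assoc, ← mul_assoc, K_mul_F, smul_mul_assoc,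
        smul_mul_assoc, mul_assoc X.F, K_mul_E, mul_smul_comm, smul_mul_assoc, smul_smul,
        qpow_neg_mul, one_smul, mul_assoc, mul_assoc, X.K_mul_Kinv, mul_one]
    have h2 : X.E * X.Kinv * (X.K * X.F) = X.E * X.F := by
      rw [mul_assoc, ← mul_assoc X.Kinv, X.Kinv_mul_K, one_mul]
    rw [neg_mul_neg, neg_mul_neg, h1, h2, ← neg_sub (X.E * X.F), X.E_F, ← smul_neg, neg_sub]
  H_K := by
    rw [dualMap_mul, dualMap_mul]
    congr 1
    rw [mul_neg, neg_mul, H_mul_Kinv]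
  H_E := by
    rw [dualMap_mul, dualMap_mul, dualMap_sub, dualMap_smul]
    congr 1
    rw [neg_mul_neg, neg_mul_neg, mul_assoc, ← H_mul_Kinv, ← mul_assoc, ← mul_assoc, ← sub_mul,
      ← neg_sub (X.H * X.E), X.H_E, neg_mul, smul_neg, smul_mul_assoc]
  H_F := by
    rw [dualMap_mul, dualMap_mul, dualMap_sub, dualMap_smul]
    congr 1
    rw [neg_mul_neg, neg_mul_neg, ← mul_assoc, X.H_K, mul_assoc, mul_assoc, ← mul_sub,
      ← neg_sub (X.H * X.F), X.H_F, mul_neg, smul_neg, mul_smul_comm]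
  E_pow := by
    obtain ⟨c, hc⟩ := E_mul_Kinv_pow X r
    rw [dualMap_pow, neg_pow, hc, X.E_pow, zero_mul, smul_zero, mul_zero, dualMap_zero]
  F_pow := by
    obtain ⟨c, hc⟩ := K_mul_F_pow X r
    rw [dualMap_pow, neg_pow, hc, X.F_pow, zero_mul, smul_zero, mul_zero, dualMap_zero]
  iSup_weightSpace := by
    obtain ⟨ι, _, _, b, μ, hH, -, -⟩ := exists_weightBasis X
    rw [eq_top_iff, ← b.dualBasis.span_eq, Submodule.span_le]
    rintro _ ⟨i, rfl⟩
    refine Submodule.mem_iSup_of_mem (-μ i) (Module.End.mem_eigenspace_iff.mpr ?_)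
    refine b.ext fun j => ?_
    by_cases h : j = i
    · subst h; simp [LinearMap.dualMap_apply, hH]
    · simp [LinearMap.dualMap_apply, hH, h]
  K_weight := by
    obtain ⟨ι, _, _, b, μ, hH, -, hKinv⟩ := exists_weightBasis X
    refine weight_of_basis b.dualBasis (fun i => -μ i) _ _ _ (fun i => ?_) fun i => ?_
    · refine b.ext fun j => ?_
      by_cases h : j = i
      · subst h; simp [LinearMap.dualMap_apply, hH]
      · simp [LinearMap.dualMap_apply, hH, h]
    · refine b.ext fun j => ?_
      by_cases h : j = i
      · subst h; simp [LinearMap.dualMap_apply, hKinv]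
      · simp [LinearMap.dualMap_apply, hKinv, h]

/-! ### Tensor products -/

lemma add_pow_eq_zero_of_qcomm {A : Type} [Ring A] [Algebra ℂ A] (a b : A) (ω : ℂ) (r : ℕ)
    (hr : r ≠ 0) (hab : b * a = ω • (a * b)) (ha : a ^ r = 0) (hb : b ^ r = 0)
    (h0 : ∑ j ∈ Finset.range r, ω ^ j = 0)
    (hS : ∀ n, n ≠ 0 → n < r → ∑ j ∈ Finset.range n, ω ^ j ≠ 0) : (a + b) ^ r = 0 := by
  let S : ℕ → ℂ := fun n => ∑ j ∈ Finset.range n, ω ^ j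
  let fac : ℕ → ℂ := fun n => ∏ j ∈ Finset.range n, S (j + 1)
  have hSadd : ∀ i j, S i + ω ^ i * S j = S (i + j) := fun i j => by
    simp only [S, Finset.sum_range_add, Finset.mul_sum, pow_add]
  have hdiv : ∀ x : A, x ^ r = 0 → ∀ i, i + 1 ≤ r →
      x * ((fac i)⁻¹ • x ^ i) = S (i + 1) • ((fac (i + 1))⁻¹ • x ^ (i + 1)) := by
    intro x hx i hi
    rw [mul_smul_comm, ← pow_succ', smul_smul]
    rcases eq_or_lt_of_le hi with h | h
    · rw [h, hx, smul_zero, smul_zero]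
    · have := hS (i + 1) (by omega) h
      congr 1
      simp only [fac]
      rw [Finset.prod_range_succ _ i, mul_inv, mul_left_comm, mul_inv_cancel₀ this, mul_one]
  have hba : ∀ i, b * a ^ i = ω ^ i • (a ^ i * b) := by
    intro i
    induction i with
    | zero => simp
    | succ i ih =>
      rw [pow_succ, ← mul_assoc, ih, smul_mul_assoc, mul_assoc, hab, mul_smul_comm, smul_smul,
        mul_assoc, ← pow_succ]
  let T : ℕ → A := fun n => ∑ p ∈ Finset.HasAntidiagonal.antidiagonal n,
    ((fac p.1)⁻¹ • a ^ p.1) * ((fac p.2)⁻¹ • b ^ p.2)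
  have hT : ∀ n, n + 1 ≤ r → (a + b) * T n = S (n + 1) • T (n + 1) := by
    intro n hn
    have e1 : S (n + 1) • T (n + 1) = ∑ p ∈ Finset.HasAntidiagonal.antidiagonal (n + 1),
        (S p.1 • (((fac p.1)⁻¹ • a ^ p.1) * ((fac p.2)⁻¹ • b ^ p.2)) +
          (ω ^ p.1 * S p.2) • (((fac p.1)⁻¹ • a ^ p.1) * ((fac p.2)⁻¹ • b ^ p.2))) := by
      rw [Finset.smul_sum]
      refine Finset.sum_congr rfl fun p hp => ?_
      rw [← add_smul, hSadd, Finset.HasAntidiagonal.mem_antidiagonal.mp hp]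
    rw [e1, Finset.sum_add_distrib, Finset.Nat.sum_antidiagonal_succ,
      Finset.Nat.sum_antidiagonal_succ', add_mul, Finset.mul_sum, Finset.mul_sum]
    have hS0 : S 0 = 0 := by simp [S]
    simp only [hS0, zero_smul, zero_add, mul_zero]
    congr 1
    · refine Finset.sum_congr rfl fun p hp => ?_
      have hp := Finset.HasAntidiagonal.mem_antidiagonal.mp hp
      rw [← mul_assoc, hdiv a ha p.1 (by omega), smul_mul_assoc]
    · refine Finset.sum_congr rfl fun p hp => ?_
      have hp := Finset.HasAntidiagonal.mem_antidiagonal.mp hp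
      have e : b * ((fac p.1)⁻¹ • a ^ p.1) = ω ^ p.1 • (((fac p.1)⁻¹ • a ^ p.1) * b) := by
        rw [mul_smul_comm, hba, smul_comm, smul_mul_assoc]
      rw [mul_smul, ← mul_smul_comm, ← hdiv b hb p.2 (by omega), ← mul_assoc, e, smul_mul_assoc,
        mul_assoc]
  have hpow : ∀ n, n ≤ r → (a + b) ^ n = fac n • T n := by
    intro n
    induction n with
    | zero => intro _; simp [fac, T]
    | succ n ih =>
      intro hn
      rw [pow_succ', ih (by omega), mul_smul_comm, hT n hn, smul_smul]
      congr 1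
      simp only [fac]
      rw [Finset.prod_range_succ _ n]
  obtain ⟨n, rfl⟩ := Nat.exists_eq_succ_of_ne_zero hr
  rw [hpow _ le_rfl]
  have : fac (n + 1) = 0 := by
    simp only [fac]
    rw [Finset.prod_range_succ]
    exact mul_eq_zero_of_right _ h0
  rw [Nat.succ_eq_add_one, this, zero_smul]

lemma qpow_two_isPrimitiveRoot (r : ℕ) (hr : r ≠ 0) : IsPrimitiveRoot (qpow r 2) r := by
  have h := Complex.isPrimitiveRoot_exp r hr
  have h2 : qpow r 2 = Complex.exp (2 * Real.pi * Complex.I / r) := by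
    rw [qpow]; congr 1; ring
  rwa [h2]

lemma add_pow_eq_zero_of_qpow {A : Type} [Ring A] [Algebra ℂ A] (a b : A) (r : ℕ)
    [hr2 : r.AtLeastTwo] (hab : b * a = qpow r 2 • (a * b)) (ha : a ^ r = 0) (hb : b ^ r = 0) :
    (a + b) ^ r = 0 := by
  have hr := hr2.prop
  have hω := qpow_two_isPrimitiveRoot r (by omega)
  refine add_pow_eq_zero_of_qcomm a b (qpow r 2) r (by omega) hab ha hb
    (hω.geom_sum_eq_zero (by omega)) fun n hn hnr h => ?_
  have h1 := mul_neg_geom_sum (qpow r 2) n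
  rw [h, mul_zero] at h1
  exact hω.pow_ne_one_of_pos_of_lt hn hnr (sub_eq_zero.mp h1.symm).symm

section Tensor

open TensorProduct (map)

variable {r : ℕ} [r.AtLeastTwo] (X Y : WeightModule r)

/-- The tensor product of modules, defined with the coproduct
`Δ(E) = 1 ⊗ E + E ⊗ K`, `Δ(F) = K⁻¹ ⊗ F + F ⊗ 1`, `Δ(K) = K ⊗ K`, `Δ(H) = H ⊗ 1 + 1 ⊗ H`. -/
@[reducible] def tensorObj : WeightModule r where
  carrier := X ⊗[ℂ] Y
  E := map 1 Y.E + map X.E Y.K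
  F := map X.Kinv Y.F + map X.F 1
  H := map X.H 1 + map 1 Y.H
  K := map X.K Y.K
  Kinv := map X.Kinv Y.Kinv
  K_mul_Kinv := by rw [← TensorProduct.map_mul, X.K_mul_Kinv, Y.K_mul_Kinv, TensorProduct.map_one]
  Kinv_mul_K := by rw [← TensorProduct.map_mul, X.Kinv_mul_K, Y.Kinv_mul_K, TensorProduct.map_one]
  K_E := by
    rw [mul_add, add_mul]
    simp only [← TensorProduct.map_mul, X.K_E, Y.K_E, mul_one, X.K_mul_Kinv]
    rw [mul_assoc Y.K, Y.K_mul_Kinv, mul_one, TensorProduct.map_smul_left,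
      TensorProduct.map_smul_right, smul_add]
  K_F := by
    rw [mul_add, add_mul]
    simp only [← TensorProduct.map_mul, X.K_F, Y.K_F, mul_one, Y.K_mul_Kinv, X.K_mul_Kinv, one_mul]
    rw [TensorProduct.map_smul_left, TensorProduct.map_smul_right, smul_add]
  E_F := by
    have hE : X.E * X.F = X.F * X.E + (qn r 1)⁻¹ • (X.K - X.Kinv) := by
      rw [← X.E_F, add_sub_cancel]
    have hE' : Y.E * Y.F = Y.F * Y.E + (qn r 1)⁻¹ • (Y.K - Y.Kinv) := by
      rw [← Y.E_F, add_sub_cancel]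
    have h1 : map (X.Kinv * X.E) (Y.F * Y.K) = map (X.E * X.Kinv) (Y.K * Y.F) := by
      rw [Kinv_mul_E, K_mul_F, TensorProduct.map_smul_left, TensorProduct.map_smul_right]
    have s1 : ∀ (A B : Module.End ℂ X) (C : Module.End ℂ Y),
        map (A - B) C = map A C - map B C := fun A B C =>
        TensorProduct.ext' fun x y => by simp [TensorProduct.sub_tmul]
    have s2 : ∀ (A : Module.End ℂ X) (B C : Module.End ℂ Y),
        map A (B - C) = map A B - map A C := fun A B C =>
        TensorProduct.ext' fun x y => by simp [TensorProduct.tmul_sub]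
    simp only [mul_add, add_mul, ← TensorProduct.map_mul, one_mul, mul_one, hE, hE', h1,
      TensorProduct.map_add_left, TensorProduct.map_add_right, TensorProduct.map_smul_left,
      TensorProduct.map_smul_right, s1, s2]
    module
  H_K := by
    simp only [mul_add, add_mul, ← TensorProduct.map_mul, one_mul, mul_one, X.H_K, Y.H_K]
  H_E := by
    have hE : X.H * X.E = X.E * X.H + (2 : ℂ) • X.E := by rw [← X.H_E, add_sub_cancel]
    have hE' : Y.H * Y.E = Y.E * Y.H + (2 : ℂ) • Y.E := by rw [← Y.H_E, add_sub_cancel]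
    simp only [mul_add, add_mul, ← TensorProduct.map_mul, one_mul, mul_one, hE, hE', Y.H_K,
      TensorProduct.map_add_left, TensorProduct.map_add_right, TensorProduct.map_smul_left,
      TensorProduct.map_smul_right]
    module
  H_F := by
    have hF : X.H * X.F = X.F * X.H + (-2 : ℂ) • X.F := by rw [← X.H_F, add_sub_cancel]
    have hF' : Y.H * Y.F = Y.F * Y.H + (-2 : ℂ) • Y.F := by rw [← Y.H_F, add_sub_cancel]
    simp only [mul_add, add_mul, ← TensorProduct.map_mul, one_mul, mul_one, hF, hF', H_mul_Kinv,
      TensorProduct.map_add_left, TensorProduct.map_add_right, TensorProduct.map_smul_left,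
      TensorProduct.map_smul_right]
    module
  E_pow := by
    refine add_pow_eq_zero_of_qpow _ _ r ?_ ?_ ?_
    · rw [← TensorProduct.map_mul, ← TensorProduct.map_mul, K_mul_E, one_mul, mul_one,
        TensorProduct.map_smul_right]
    · rw [TensorProduct.map_pow, Y.E_pow, TensorProduct.map_zero_right]
    · rw [TensorProduct.map_pow, X.E_pow, TensorProduct.map_zero_left]
  F_pow := by
    rw [add_comm]
    refine add_pow_eq_zero_of_qpow _ _ r ?_ ?_ ?_
    · rw [← TensorProduct.map_mul, ← TensorProduct.map_mul, Kinv_mul_F, one_mul, mul_one,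
        TensorProduct.map_smul_left]
    · rw [TensorProduct.map_pow, X.F_pow, TensorProduct.map_zero_left]
    · rw [TensorProduct.map_pow, Y.F_pow, TensorProduct.map_zero_right]
  iSup_weightSpace := by
    obtain ⟨ι, _, _, b, μ, hH, -, -⟩ := exists_weightBasis X
    obtain ⟨ι', _, _, b', μ', hH', -, -⟩ := exists_weightBasis Y
    rw [eq_top_iff, ← (b.tensorProduct b').span_eq, Submodule.span_le]
    rintro _ ⟨i, rfl⟩
    refine Submodule.mem_iSup_of_mem (μ i.1 + μ' i.2) (Module.End.mem_eigenspace_iff.mpr ?_)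
    simp [Module.Basis.tensorProduct_apply', hH, hH', add_smul, TensorProduct.smul_tmul']
  K_weight := by
    obtain ⟨ι, _, _, b, μ, hH, hK, -⟩ := exists_weightBasis X
    obtain ⟨ι', _, _, b', μ', hH', hK', -⟩ := exists_weightBasis Y
    refine weight_of_basis (b.tensorProduct b') (fun i => μ i.1 + μ' i.2) _ _ _
      (fun i => ?_) fun i => ?_
    · simp [Module.Basis.tensorProduct_apply', hH, hH', add_smul, TensorProduct.smul_tmul']
    · simp [Module.Basis.tensorProduct_apply', hK, hK', qpow_add, TensorProduct.smul_tmul',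
        smul_smul, mul_comm]

end Tensor

/-! ### The category of finite dimensional weight modules -/

/-- Morphisms of modules: the linear maps that commute with the generators. -/
def homSubmodule {r : ℕ} (X Y : WeightModule r) : Submodule ℂ (X →ₗ[ℂ] Y) where
  carrier := {f | f ∘ₗ X.E = Y.E ∘ₗ f ∧ f ∘ₗ X.F = Y.F ∘ₗ f ∧ f ∘ₗ X.H = Y.H ∘ₗ f ∧
    f ∘ₗ X.K = Y.K ∘ₗ f ∧ f ∘ₗ X.Kinv = Y.Kinv ∘ₗ f}
  add_mem' := by
    rintro f g ⟨h1, h2, h3, h4, h5⟩ ⟨k1, k2, k3, k4, k5⟩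
    simp [LinearMap.add_comp, LinearMap.comp_add, *]
  zero_mem' := by simp
  smul_mem' := by
    rintro c f ⟨h1, h2, h3, h4, h5⟩
    simp [LinearMap.smul_comp, LinearMap.comp_smul, *]

lemma mem_homSubmodule {r : ℕ} {X Y : WeightModule r} (f : X →ₗ[ℂ] Y)
    (hE : f ∘ₗ X.E = Y.E ∘ₗ f) (hF : f ∘ₗ X.F = Y.F ∘ₗ f) (hH : f ∘ₗ X.H = Y.H ∘ₗ f)
    (hK : f ∘ₗ X.K = Y.K ∘ₗ f) : f ∈ homSubmodule X Y := by
  refine ⟨hE, hF, hH, hK, ?_⟩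
  calc f ∘ₗ X.Kinv = (Y.Kinv * Y.K) ∘ₗ f ∘ₗ X.Kinv := by rw [Y.Kinv_mul_K]; rfl
    _ = Y.Kinv ∘ₗ (Y.K ∘ₗ f) ∘ₗ X.Kinv := rfl
    _ = Y.Kinv ∘ₗ f ∘ₗ (X.K * X.Kinv) := by rw [← hK]; rfl
    _ = Y.Kinv ∘ₗ f := by rw [X.K_mul_Kinv]; rfl

instance (r : ℕ) : Category (WeightModule r) where
  Hom X Y := homSubmodule X Y
  id X := ⟨LinearMap.id, rfl, rfl, rfl, rfl, rfl⟩
  comp {X Y Z} f g := ⟨g.1 ∘ₗ f.1, by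
    obtain ⟨f, h1, h2, h3, h4, h5⟩ := f
    obtain ⟨g, k1, k2, k3, k4, k5⟩ := g
    refine ⟨?_, ?_, ?_, ?_, ?_⟩
    · simp only [LinearMap.comp_assoc, h1]; simp only [← LinearMap.comp_assoc, k1]
    · simp only [LinearMap.comp_assoc, h2]; simp only [← LinearMap.comp_assoc, k2]
    · simp only [LinearMap.comp_assoc, h3]; simp only [← LinearMap.comp_assoc, k3]
    · simp only [LinearMap.comp_assoc, h4]; simp only [← LinearMap.comp_assoc, k4]
    · simp only [LinearMap.comp_assoc, h5]; simp only [← LinearMap.comp_assoc, k5]⟩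

/-- The linear map underlying a morphism. -/
def toLin {r : ℕ} {X Y : WeightModule r} (f : X ⟶ Y) : X →ₗ[ℂ] Y := Subtype.val f

/-- The morphism given by a linear map that commutes with `E, F, H, K`. -/
def homMk {r : ℕ} {X Y : WeightModule r} (f : X →ₗ[ℂ] Y)
    (hE : f ∘ₗ X.E = Y.E ∘ₗ f) (hF : f ∘ₗ X.F = Y.F ∘ₗ f) (hH : f ∘ₗ X.H = Y.H ∘ₗ f)
    (hK : f ∘ₗ X.K = Y.K ∘ₗ f) : X ⟶ Y := ⟨f, mem_homSubmodule f hE hF hH hK⟩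

instance (r : ℕ) : Preadditive (WeightModule r) where
  homGroup X Y := inferInstanceAs (AddCommGroup (homSubmodule X Y))
  add_comp _ _ _ f f' g := Subtype.ext (LinearMap.comp_add f.1 f'.1 g.1)
  comp_add _ _ _ f g g' := Subtype.ext (LinearMap.add_comp f.1 g'.1 g.1)

instance (r : ℕ) : Linear ℂ (WeightModule r) where
  homModule X Y := inferInstanceAs (Module ℂ (homSubmodule X Y))
  smul_comp _ _ _ c f g := Subtype.ext (LinearMap.comp_smul g.1 c f.1)
  comp_smul _ _ _ f c g := Subtype.ext (LinearMap.smul_comp c g.1 f.1)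

lemma toLin_E {r : ℕ} {X Y : WeightModule r} (f : X ⟶ Y) (v : X) :
    toLin f (X.E v) = Y.E (toLin f v) := LinearMap.congr_fun f.2.1 v

lemma toLin_F {r : ℕ} {X Y : WeightModule r} (f : X ⟶ Y) (v : X) :
    toLin f (X.F v) = Y.F (toLin f v) := LinearMap.congr_fun f.2.2.1 v

lemma toLin_H {r : ℕ} {X Y : WeightModule r} (f : X ⟶ Y) (v : X) :
    toLin f (X.H v) = Y.H (toLin f v) := LinearMap.congr_fun f.2.2.2.1 v

lemma toLin_K {r : ℕ} {X Y : WeightModule r} (f : X ⟶ Y) (v : X) :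
    toLin f (X.K v) = Y.K (toLin f v) := LinearMap.congr_fun f.2.2.2.2.1 v

lemma toLin_Kinv {r : ℕ} {X Y : WeightModule r} (f : X ⟶ Y) (v : X) :
    toLin f (X.Kinv v) = Y.Kinv (toLin f v) := LinearMap.congr_fun f.2.2.2.2.2 v

/-! ### Duality morphisms and the partial trace -/

section PartialTrace

variable {r : ℕ} [r.AtLeastTwo]

/-- `f ⊗ g`. -/
def tensorHom {X X' Y Y' : WeightModule r} (f : X ⟶ X') (g : Y ⟶ Y') :
    tensorObj X Y ⟶ tensorObj X' Y' :=
  homMk (X := tensorObj X Y) (Y := tensorObj X' Y') (TensorProduct.map (toLin f) (toLin g))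
    (TensorProduct.ext' fun x y => by simp [tensorObj, toLin_E, toLin_K])
    (TensorProduct.ext' fun x y => by simp [tensorObj, toLin_F, toLin_Kinv])
    (TensorProduct.ext' fun x y => by simp [tensorObj, toLin_H])
    (TensorProduct.ext' fun x y => by simp [tensorObj, toLin_K])

/-- The canonical morphism `(X ⊗ Y) ⊗ Z → X ⊗ (Y ⊗ Z)`. -/
def assocHom (X Y Z : WeightModule r) :
    tensorObj (tensorObj X Y) Z ⟶ tensorObj X (tensorObj Y Z) :=
  homMk (X := tensorObj (tensorObj X Y) Z) (Y := tensorObj X (tensorObj Y Z))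
    (TensorProduct.assoc ℂ X Y Z).toLinearMap
    (TensorProduct.ext_threefold fun x y z => by
      simp [tensorObj, TensorProduct.tmul_add, TensorProduct.add_tmul, add_assoc])
    (TensorProduct.ext_threefold fun x y z => by
      simp [tensorObj, TensorProduct.tmul_add, TensorProduct.add_tmul, add_assoc])
    (TensorProduct.ext_threefold fun x y z => by
      simp [tensorObj, TensorProduct.tmul_add, TensorProduct.add_tmul, add_assoc])
    (TensorProduct.ext_threefold fun x y z => by simp [tensorObj])

/-- The canonical morphism `X ⊗ (Y ⊗ Z) → (X ⊗ Y) ⊗ Z`. -/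
def assocInv (X Y Z : WeightModule r) :
    tensorObj X (tensorObj Y Z) ⟶ tensorObj (tensorObj X Y) Z :=
  homMk (X := tensorObj X (tensorObj Y Z)) (Y := tensorObj (tensorObj X Y) Z)
    (TensorProduct.assoc ℂ X Y Z).symm.toLinearMap
    (TensorProduct.ext_threefold' fun x y z => by
      simp [TensorProduct.tmul_add, TensorProduct.add_tmul, add_assoc])
    (TensorProduct.ext_threefold' fun x y z => by
      simp [TensorProduct.tmul_add, TensorProduct.add_tmul, add_assoc])
    (TensorProduct.ext_threefold' fun x y z => by
      simp [TensorProduct.tmul_add, TensorProduct.add_tmul, add_assoc])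
    (TensorProduct.ext_threefold' fun x y z => by simp)

/-- The canonical morphism `X ⊗ ℂ → X`. -/
def rightUnitorHom (X : WeightModule r) : tensorObj X (unitObj r) ⟶ X :=
  homMk (X := tensorObj X (unitObj r)) (TensorProduct.rid ℂ X).toLinearMap
    (TensorProduct.ext' fun x y => by simp)
    (TensorProduct.ext' fun x y => by simp)
    (TensorProduct.ext' fun x y => by simp)
    (TensorProduct.ext' fun x y => by simp)

/-- The canonical morphism `X → X ⊗ ℂ`. -/
def rightUnitorInv (X : WeightModule r) : X ⟶ tensorObj X (unitObj r) :=
  homMk (Y := tensorObj X (unitObj r)) (TensorProduct.rid ℂ X).symm.toLinearMap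
    (LinearMap.ext fun x => by simp)
    (LinearMap.ext fun x => by simp)
    (LinearMap.ext fun x => by simp)
    (LinearMap.ext fun x => by simp)

lemma map_coevaluation {V : Type} [AddCommGroup V] [Module ℂ V] [FiniteDimensional ℂ V]
    (A B : Module.End ℂ V) :
    TensorProduct.map A (LinearMap.dualMap B) (coevaluation ℂ V 1) =
      TensorProduct.map 1 (LinearMap.dualMap (A * B)) (coevaluation ℂ V 1) := by
  let b := Module.Basis.ofVectorSpace ℂ V
  simp only [coevaluation_apply_one, map_sum, TensorProduct.map_tmul, Module.End.one_apply]
  change ∑ i, A (b i) ⊗ₜ[ℂ] LinearMap.dualMap B (b.coord i) =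
    ∑ i, b i ⊗ₜ[ℂ] LinearMap.dualMap (A * B) (b.coord i)
  have h1 : ∀ i, A (b i) ⊗ₜ[ℂ] LinearMap.dualMap B (b.coord i) =
      ∑ k, b k ⊗ₜ[ℂ] (b.coord k (A (b i)) • LinearMap.dualMap B (b.coord i)) := fun i => by
    conv_lhs => rw [← b.sum_repr (A (b i)), TensorProduct.sum_tmul]
    exact Finset.sum_congr rfl fun k _ => by rw [TensorProduct.smul_tmul]; rfl
  simp only [h1]
  rw [Finset.sum_comm]
  refine Finset.sum_congr rfl fun k _ => ?_
  rw [← TensorProduct.tmul_sum]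
  congr 1
  ext v
  have h2 : A (B v) = ∑ i, b.repr (B v) i • A (b i) := by
    conv_lhs => rw [← b.sum_repr (B v), map_sum]
    simp only [map_smul]
  simp only [LinearMap.sum_apply, LinearMap.smul_apply, LinearMap.dualMap_apply,
    Module.End.mul_apply, h2, map_sum, map_smul, Module.Basis.coord_apply, smul_eq_mul]
  exact Finset.sum_congr rfl fun i _ => mul_comm _ _

/-- The left coevaluation `ℂ → V ⊗ V*`, `1 ↦ ∑ v_i ⊗ v_i*`. -/
def coev (X : WeightModule r) : unitObj r ⟶ tensorObj X (dualObj X) :=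
  have h1 : (1 : Module.End ℂ (Module.Dual ℂ X)) = LinearMap.dualMap 1 := rfl
  have hneg : ∀ A : Module.End ℂ X, TensorProduct.map (1 : Module.End ℂ X)
      (LinearMap.dualMap (-A)) = - TensorProduct.map 1 (LinearMap.dualMap A) := fun A =>
    TensorProduct.ext' fun x φ => by
      have h : LinearMap.dualMap (-A) φ = - LinearMap.dualMap A φ := by
        ext v; simp [LinearMap.dualMap_apply]
      simp [h, TensorProduct.tmul_neg]
  have hE : TensorProduct.map (1 : Module.End ℂ X) (LinearMap.dualMap (-(X.E * X.Kinv)))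
      (coevaluation ℂ X 1) + TensorProduct.map X.E (LinearMap.dualMap X.Kinv)
      (coevaluation ℂ X 1) = 0 := by
    rw [hneg, map_coevaluation X.E, LinearMap.neg_apply, neg_add_cancel]
  have hF : TensorProduct.map X.Kinv (LinearMap.dualMap (-(X.K * X.F))) (coevaluation ℂ X 1) +
      TensorProduct.map X.F (1 : Module.End ℂ (Module.Dual ℂ X)) (coevaluation ℂ X 1) = 0 := by
    rw [h1, map_coevaluation X.Kinv, map_coevaluation X.F, mul_neg, hneg, LinearMap.neg_apply,
      ← mul_assoc, X.Kinv_mul_K, one_mul, mul_one, neg_add_cancel]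
  have hH : TensorProduct.map X.H (1 : Module.End ℂ (Module.Dual ℂ X)) (coevaluation ℂ X 1) +
      TensorProduct.map (1 : Module.End ℂ X) (LinearMap.dualMap (-X.H))
      (coevaluation ℂ X 1) = 0 := by
    rw [h1, map_coevaluation X.H, hneg, LinearMap.neg_apply, mul_one, add_neg_cancel]
  have hK : TensorProduct.map X.K (LinearMap.dualMap X.Kinv) (coevaluation ℂ X 1) =
      coevaluation ℂ X 1 := by
    rw [map_coevaluation X.K, X.K_mul_Kinv, ← h1, TensorProduct.map_one, Module.End.one_apply]
  homMk (X := unitObj r) (Y := tensorObj X (dualObj X)) (coevaluation ℂ X)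
    (LinearMap.ext_ring (by
      rw [LinearMap.comp_apply, LinearMap.comp_apply, LinearMap.zero_apply, map_zero,
        LinearMap.add_apply, hE]))
    (LinearMap.ext_ring (by
      rw [LinearMap.comp_apply, LinearMap.comp_apply, LinearMap.zero_apply, map_zero,
        LinearMap.add_apply, hF]))
    (LinearMap.ext_ring (by
      rw [LinearMap.comp_apply, LinearMap.comp_apply, LinearMap.zero_apply, map_zero,
        LinearMap.add_apply, hH]))
    (LinearMap.ext_ring (by
      rw [LinearMap.comp_apply, LinearMap.comp_apply, Module.End.one_apply, hK]))

lemma Kinv_pow_mul_E (X : WeightModule r) :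
    X.Kinv ^ (r - 1) * (X.Kinv * X.E) = X.E * X.Kinv * X.Kinv ^ (r - 1) := by
  have key : ∀ n : ℕ, X.Kinv ^ n * X.E = qpow r (-2) ^ n • (X.E * X.Kinv ^ n) := by
    intro n
    induction n with
    | zero => simp
    | succ n ih =>
      rw [pow_succ, mul_assoc, Kinv_mul_E, mul_smul_comm, ← mul_assoc, ih, smul_mul_assoc,
        smul_smul, mul_assoc, ← pow_succ, ← pow_succ']
  have hr := Nat.AtLeastTwo.prop (n := r)
  have h : qpow r (-2) ^ r = 1 := by
    have h1 := (qpow_two_isPrimitiveRoot r (by omega)).pow_eq_one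
    have h2 := congrArg (· ^ r) (qpow_neg_mul r 2)
    simpa [mul_pow, h1] using h2
  rw [← mul_assoc, ← pow_succ, mul_assoc, ← pow_succ', Nat.sub_add_cancel (by omega), key, h,
    one_smul]

lemma Kinv_pow_mul_F (X : WeightModule r) :
    X.Kinv ^ (r - 1) * X.F = X.K * X.F * (X.Kinv ^ (r - 1) * X.Kinv) := by
  have key : ∀ n : ℕ, X.Kinv ^ n * X.F = qpow r 2 ^ n • (X.F * X.Kinv ^ n) := by
    intro n
    induction n with
    | zero => simp
    | succ n ih =>
      rw [pow_succ, mul_assoc, Kinv_mul_F, mul_smul_comm, ← mul_assoc, ih, smul_mul_assoc,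
        smul_smul, mul_assoc, ← pow_succ, ← pow_succ']
  have hr := Nat.AtLeastTwo.prop (n := r)
  have h := (qpow_two_isPrimitiveRoot r (by omega)).pow_eq_one
  have h1 : X.F * (X.Kinv ^ (r - 1) * X.Kinv) = X.Kinv * (X.Kinv ^ (r - 1) * X.F) := by
    rw [← mul_assoc X.Kinv, ← pow_succ, ← pow_succ', Nat.sub_add_cancel (by omega), key, h,
      one_smul]
  rw [mul_assoc, h1, ← mul_assoc, X.K_mul_Kinv, one_mul]

/-- The right evaluation `V ⊗ V* → ℂ`, `v ⊗ f ↦ f (K^{1 - r} v)`. -/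
def evR (X : WeightModule r) : tensorObj X (dualObj X) ⟶ unitObj r :=
  have hc : X.Kinv * X.Kinv ^ (r - 1) = X.Kinv ^ (r - 1) * X.Kinv :=
    (pow_succ' _ _).symm.trans (pow_succ _ _)
  have hH : X.H * X.Kinv ^ (r - 1) = X.Kinv ^ (r - 1) * X.H :=
    (Commute.pow_right (show Commute X.H X.Kinv from H_mul_Kinv X) _).eq
  homMk (X := tensorObj X (dualObj X)) (Y := unitObj r)
    (TensorProduct.lift ((LinearMap.id : Module.Dual ℂ X →ₗ[ℂ] Module.Dual ℂ X).flip ∘ₗ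
      (X.Kinv ^ (r - 1))))
    (TensorProduct.ext' fun x φ => by
      have := congrArg φ (LinearMap.congr_fun (Kinv_pow_mul_E X) x)
      have h' := congrArg φ (LinearMap.congr_fun hc (X.E x))
      simp only [Module.End.mul_apply] at this h'
      simp [LinearMap.dualMap_apply, h', this])
    (TensorProduct.ext' fun x φ => by
      have := congrArg φ (LinearMap.congr_fun (Kinv_pow_mul_F X) x)
      simp only [Module.End.mul_apply] at this
      simp [LinearMap.dualMap_apply, this])
    (TensorProduct.ext' fun x φ => by
      have := congrArg φ (LinearMap.congr_fun hH x)
      simp only [Module.End.mul_apply] at this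
      simp [LinearMap.dualMap_apply, this])
    (TensorProduct.ext' fun x φ => by
      have h0 : X.Kinv * X.Kinv ^ (r - 1) * X.K = X.Kinv ^ (r - 1) := by
        rw [hc, mul_assoc, X.Kinv_mul_K, mul_one]
      have := congrArg φ (LinearMap.congr_fun h0 x)
      simp only [Module.End.mul_apply] at this
      simp [LinearMap.dualMap_apply, this])

/-- The right partial trace `(Id ⊗ ev) ∘ (f ⊗ Id) ∘ (Id ⊗ coev)` of an endomorphism of `U ⊗ W`,
where `ev` is the right evaluation and `coev` the left coevaluation. -/
def ptrR (U W : WeightModule r) (f : tensorObj U W ⟶ tensorObj U W) : U ⟶ U :=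
  rightUnitorInv U ≫ tensorHom (𝟙 U) (coev W) ≫ assocInv U W (dualObj W) ≫
    tensorHom f (𝟙 (dualObj W)) ≫ assocHom U W (dualObj W) ≫
    tensorHom (𝟙 U) (evR W) ≫ rightUnitorHom U

end PartialTrace

/-! ### Modified traces -/

/-- A trace on the ideal of projective objects: linear maps `t_V : End(V) → ℂ`, one for each
projective object `V` of the category of weight modules, compatible with the right partial trace
and cyclic. -/
structure ModifiedTrace (r : ℕ) [r.AtLeastTwo] where
  tr : ∀ V : WeightModule r, Projective V → ((V ⟶ V) →ₗ[ℂ] ℂ)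
  tr_tensor : ∀ (U W : WeightModule r) (hU : Projective U) (hUW : Projective (tensorObj U W))
    (f : tensorObj U W ⟶ tensorObj U W), tr (tensorObj U W) hUW f = tr U hU (ptrR U W f)
  tr_comm : ∀ (U V : WeightModule r) (hU : Projective U) (hV : Projective V)
    (f : V ⟶ U) (g : U ⟶ V), tr V hV (f ≫ g) = tr U hU (g ≫ f)

/-- The normalization `d(V_α) = t(Id_{V_α}) = d₀ {α} / {r α}` for `α ∈ ℂ ∖ ℤ`. -/
def ModifiedTrace.IsNormalized {r : ℕ} [r.AtLeastTwo] (t : ModifiedTrace r) (d₀ : ℝ) : Prop :=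
  ∀ α : ℂ, (∀ n : ℤ, α ≠ n) → ∀ h : Projective (Valpha r α),
    t.tr (Valpha r α) h (𝟙 (Valpha r α)) = d₀ * qn r α / qn r (r * α)

/-! ### The subcategory generated by `V_α`, `S_n`, `P_i`, `ℂ^H_{ar}` -/

/-- `P` is a projective cover of `S`. -/
def IsProjectiveCover {r : ℕ} (P S : WeightModule r) : Prop :=
  Projective P ∧ ∃ p : P ⟶ S, Epi p ∧
    ∀ (Q : WeightModule r) (h : Q ⟶ P), Epi (h ≫ p) → Epi h

/-- The generating objects: `V_α` with `α ∈ (ℝ ∖ ℤ) ∪ r ℤ`, the simple modules `S_n` and their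
projective covers `P_n` (`0 ≤ n ≤ r - 2`), and `ℂ^H_{ar}` with `a ∈ ℤ`. -/
inductive IsGenerator (r : ℕ) [r.AtLeastTwo] : WeightModule r → Prop
  | V (α : ℝ) (hα : (∀ n : ℤ, α ≠ n) ∨ ∃ k : ℤ, α = r * k) : IsGenerator r (Valpha r α)
  | S (n : ℕ) (hn : n + 2 ≤ r) : IsGenerator r (Smod r n hn)
  | P (n : ℕ) (hn : n + 2 ≤ r) (P : WeightModule r) (hP : IsProjectiveCover P (Smod r n hn)) :
      IsGenerator r P
  | C (a : ℤ) : IsGenerator r (CH r a)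

/-- The tensor products `X_1 ⊗ ⋯ ⊗ X_p`, `p ≥ 1`, where each `X_i` is a generating object or the
dual of one. (The unit object need not be added: it is isomorphic to `S_0`.) -/
inductive IsTensorWord (r : ℕ) [r.AtLeastTwo] : WeightModule r → Prop
  | of (X : WeightModule r) (hX : IsGenerator r X) : IsTensorWord r X
  | dual (X : WeightModule r) (hX : IsGenerator r X) : IsTensorWord r (dualObj X)
  | tensor (X Y : WeightModule r) (hX : IsTensorWord r X) (hY : IsTensorWord r Y) :
      IsTensorWord r (tensorObj X Y)

/-- The objects of the subcategory generated by the generating objects: finite direct sums of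
retracts of tensor products of generating objects and their duals. -/
def InGenerated {r : ℕ} [r.AtLeastTwo] (W : WeightModule r) : Prop :=
  ∃ (n : ℕ) (X T : Fin n → WeightModule r) (ι : ∀ i, X i ⟶ W) (π : ∀ i, W ⟶ X i),
    (∀ i, IsTensorWord r (T i) ∧ Nonempty (Retract (X i) (T i))) ∧
    (∀ i, ι i ≫ π i = 𝟙 (X i)) ∧ (∀ i j, i ≠ j → ι i ≫ π j = 0) ∧
    ∑ i, π i ≫ ι i = 𝟙 W

/-! ### Hermitian modules and the adjoint -/

/-- A Hermitian structure: a non-degenerate Hermitian form, antilinear in the first variable, with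
`(x† v, w) = (v, x w)`, where `†` is the antilinear antiautomorphism of the algebra with
`E† = F`, `F† = E`, `H† = H`, `K† = K⁻¹` (it suffices to require this for the generators). -/
structure HermitianStructure {r : ℕ} (X : WeightModule r) where
  form : X →ₗ⋆[ℂ] X →ₗ[ℂ] ℂ
  symm : ∀ v w, form v w = conj (form w v)
  nondegenerate : ∀ v, (∀ w, form v w = 0) → v = 0
  form_E : ∀ v w, form (X.F v) w = form v (X.E w)
  form_F : ∀ v w, form (X.E v) w = form v (X.F w)
  form_H : ∀ v w, form (X.H v) w = form v (X.H w)
  form_K : ∀ v w, form (X.Kinv v) w = form v (X.K w)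
  form_Kinv : ∀ v w, form (X.K v) w = form v (X.Kinv w)

/-- Objects of the category of Hermitian modules that belong to the generated subcategory; the
morphisms are all morphisms of the underlying modules. -/
structure HermitianObj (r : ℕ) [r.AtLeastTwo] where
  obj : WeightModule r
  mem : InGenerated obj
  herm : HermitianStructure obj

section Dagger

variable {r : ℕ}

namespace HermitianStructure

variable {X : WeightModule r} (h : HermitianStructure X)

lemma form_injective {v v' : X} (hv : ∀ w, h.form v w = h.form v' w) : v = v' :=
  sub_eq_zero.mp (h.nondegenerate _ fun w => by rw [map_sub, LinearMap.sub_apply, hv, sub_self])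

lemma form_surjective (φ : X →ₗ[ℂ] ℂ) : ∃ v, h.form v = φ := by
  let B : X →ₗ[ℝ] Module.Dual ℂ X :=
    { toFun := fun v => h.form v
      map_add' := map_add h.form
      map_smul' := fun c v => by
        rw [← Complex.coe_smul, LinearMap.map_smulₛₗ, Complex.conj_ofReal, Complex.coe_smul]
        rfl }
  have hB : Function.Injective B := fun v v' hv =>
    h.form_injective fun w => LinearMap.congr_fun hv w
  have hd : Module.finrank ℝ X = Module.finrank ℝ (Module.Dual ℂ X) := by
    rw [finrank_real_of_complex, finrank_real_of_complex, Subspace.dual_finrank_eq]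
  exact (LinearMap.injective_iff_surjective_of_finrank_eq_finrank hd).mp hB φ

/-- The vector that represents a linear form. -/
def repr (φ : X →ₗ[ℂ] ℂ) : X := (h.form_surjective φ).choose

lemma form_repr (φ : X →ₗ[ℂ] ℂ) (w : X) : h.form (h.repr φ) w = φ w :=
  LinearMap.congr_fun (h.form_surjective φ).choose_spec w

end HermitianStructure

variable {X Y : WeightModule r} (hX : HermitianStructure X) (hY : HermitianStructure Y)

/-- The linear map underlying the adjoint. -/
def adjointLin (f : X ⟶ Y) : Y →ₗ[ℂ] X where
  toFun w := hX.repr (hY.form w ∘ₗ toLin f)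
  map_add' w w' := hX.form_injective fun v => by
    simp [HermitianStructure.form_repr]
  map_smul' c w := hX.form_injective fun v => by
    simp [HermitianStructure.form_repr]

lemma form_adjointLin (f : X ⟶ Y) (w : Y) (v : X) :
    hX.form (adjointLin hX hY f w) v = hY.form w (toLin f v) :=
  HermitianStructure.form_repr _ _ _

/-- The adjoint `f† : Y → X` of a morphism `f : X → Y` of Hermitian modules. -/
def adjoint (f : X ⟶ Y) : Y ⟶ X :=
  homMk (adjointLin hX hY f)
    (LinearMap.ext fun w => hX.form_injective fun v => by
      simp only [LinearMap.comp_apply, form_adjointLin, hX.form_F, hY.form_F, toLin_F])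
    (LinearMap.ext fun w => hX.form_injective fun v => by
      simp only [LinearMap.comp_apply, form_adjointLin, hX.form_E, hY.form_E, toLin_E])
    (LinearMap.ext fun w => hX.form_injective fun v => by
      simp only [LinearMap.comp_apply, form_adjointLin, hX.form_H, hY.form_H, toLin_H])
    (LinearMap.ext fun w => hX.form_injective fun v => by
      simp only [LinearMap.comp_apply, form_adjointLin, hX.form_Kinv, hY.form_Kinv, toLin_Kinv])

/-- The defining property `(w, f v)_Y = (f† w, v)_X` of the adjoint. -/
lemma form_adjoint (f : X ⟶ Y) (w : Y) (v : X) :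
    hY.form w (toLin f v) = hX.form (toLin (adjoint hX hY f) w) v :=
  (form_adjointLin hX hY f w v).symm

end Dagger

/-- The adjoint of a morphism in the category of Hermitian modules. -/
def HermitianObj.dagger {r : ℕ} [r.AtLeastTwo] {V W : HermitianObj r} (f : V.obj ⟶ W.obj) :
    W.obj ⟶ V.obj := adjoint V.herm W.herm f

/-- A Hermitian pairing on a complex vector space: linear in the second variable and conjugate
symmetric (hence antilinear in the first variable). -/
structure IsHermitianPairing {M : Type} [AddCommGroup M] [Module ℂ M] (B : M → M → ℂ) : Prop where
  add_right : ∀ x y z, B x (y + z) = B x y + B x z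
  smul_right : ∀ (c : ℂ) (x y), B x (c • y) = c * B x y
  symm : ∀ x y, B x y = conj (B y x)

/-- Non-degeneracy: the kernel `{x | B x = 0}` is zero. -/
def IsNondegeneratePairing {M : Type} [AddCommGroup M] (B : M → M → ℂ) : Prop :=
  ∀ x, (∀ y, B x y = 0) → x = 0

end

end UnrolledQuantum

open UnrolledQuantum

/-! The modified trace is reduced to an ordinary weighted trace by an averaging operator. Linear
maps `X → Y` carry the adjoint action, that is, the action on `Y ⊗ X*`, and `average` is the action
of `E ^ (r - 1) F ^ (r - 1)`. In weight zero, which means on maps that commute with `H`, this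
element equals `F ^ (r - 1) E ^ (r - 1)`. Since `E ^ r = F ^ r = 0`, its image is killed by both `E`
and `F`, so the average of a weight-preserving linear map is a morphism (`averageHom`). Averaging
commutes with composition with morphisms, with `- ⊗ 1` and with the right partial trace, all by
`average_intertwine`.

On `V_α` the average of `ρ` is a scalar matrix, namely `Valpha.scalar r α` times the trace of `K ^
(1 - r) ρ` (`Valpha.average_eq`). The factor is nonzero for `α ∉ ℤ`, so the identity of such a `V_α`
is an average. A projective `P` is a retract of `V ⊗ (V* ⊗ P)` with `V = V_{1/2}`; hence its
identity, and then every endomorphism of `P`, is an average (`IsAveraged.of_projective`,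
`IsAveraged.exists_averageHom`). Cyclicity and the partial trace property move the modified trace
from `P` to `V`, which gives `t_P (average φ) = c * quantumTrace P φ` with one constant `c` for all
`P`; it is real, and nonzero if `d₀ ≠ 0` (`ModifiedTrace.exists_tr_averageHom`).

Reality of the trace: the adjoint of the average of `φ` is the average of `φ† K ^ (2 (r - 1))`
(`adj_average`), and the quantum trace of that map is the conjugate of the quantum trace of `φ`
(`quantumTrace_adj`). Non-degeneracy: if `f ≠ 0`, a rank-one weight-preserving `φ` satisfies
`quantumTrace (f φ) ≠ 0`, and by naturality the average of `φ` pairs with `f` to `c` times this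
number. -/

namespace UnrolledQuantum

/-! ### Weight vectors -/

section WeightVectors

variable {r : ℕ} (X : WeightModule r)

lemma Kinv_apply_of_weight {l : ℂ} {v : X} (h : X.H v = l • v) :
    X.Kinv v = qpow r (-l) • v := by
  have h1 := LinearMap.congr_fun X.Kinv_mul_K v
  rw [Module.End.mul_apply, X.K_weight l v h, map_smul, Module.End.one_apply] at h1
  calc X.Kinv v = (qpow r (-l) * qpow r l) • X.Kinv v := by rw [qpow_neg_mul, one_smul]
    _ = _ := by rw [mul_smul, h1]

lemma H_E_apply (v : X) : X.H (X.E v) = X.E (X.H v) + (2 : ℂ) • X.E v := by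
  have := LinearMap.congr_fun X.H_E v
  simp only [LinearMap.sub_apply, Module.End.mul_apply, LinearMap.smul_apply] at this
  rw [← this, add_sub_cancel]

lemma H_F_apply (v : X) : X.H (X.F v) = X.F (X.H v) + (-2 : ℂ) • X.F v := by
  have := LinearMap.congr_fun X.H_F v
  simp only [LinearMap.sub_apply, Module.End.mul_apply, LinearMap.smul_apply] at this
  rw [← this, add_sub_cancel]

lemma E_F_apply (v : X) :
    X.E (X.F v) = X.F (X.E v) + (qn r 1)⁻¹ • (X.K v - X.Kinv v) := by
  have := LinearMap.congr_fun X.E_F v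
  simp only [LinearMap.sub_apply, Module.End.mul_apply, LinearMap.smul_apply] at this
  rw [← this, add_sub_cancel]

lemma H_E_pow_apply {l : ℂ} {v : X} (h : X.H v = l • v) (n : ℕ) :
    X.H ((X.E ^ n) v) = (l + 2 * n) • (X.E ^ n) v := by
  induction n with
  | zero => simpa using h
  | succ n ih =>
    rw [pow_succ', Module.End.mul_apply, H_E_apply, ih, map_smul, ← add_smul]
    congr 1; push_cast; ring

lemma H_F_pow_apply {l : ℂ} {v : X} (h : X.H v = l • v) (n : ℕ) :
    X.H ((X.F ^ n) v) = (l - 2 * n) • (X.F ^ n) v := by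
  induction n with
  | zero => simpa using h
  | succ n ih =>
    rw [pow_succ', Module.End.mul_apply, H_F_apply, ih, map_smul, ← add_smul]
    congr 1; push_cast; ring

/-- The usual `sl(2)` commutation of `E` past `F ^ (n + 1)`; the coefficients telescope by
`qN_mul_identity` with `m = 0`. At weight zero the coefficient is the same as in
`F_E_pow_succ_apply`, where the roles of `E` and `F` are exchanged. -/
lemma E_F_pow_succ_apply {v : X} (h : X.H v = 0) (n : ℕ) :
    X.E ((X.F ^ (n + 1)) v) =
      (X.F ^ n) (X.F (X.E v) + (qN r (n + 1) * qN r (-n)) • v) := by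
  have h' : X.H v = (0 : ℂ) • v := by rw [h, zero_smul]
  induction n with
  | zero =>
    have h1 := X.K_weight 0 v h'
    have h2 := Kinv_apply_of_weight X h'
    rw [neg_zero] at h2
    simp [E_F_apply, h1, h2, qN, qn_zero]
  | succ n ih =>
    have hw := H_F_pow_apply X h' (n + 1)
    have hid := qN_mul_identity r (n + 1) 0
    rw [pow_succ', Module.End.mul_apply, E_F_apply, ih, X.K_weight _ _ hw,
      Kinv_apply_of_weight X hw, ← sub_smul, ← qn, smul_smul]
    rw [← Module.End.mul_apply X.F, ← pow_succ', map_add, map_add, add_assoc, map_smul, map_smul,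
      ← add_smul]
    congr 2
    rw [zero_sub, zero_sub, zero_add, show (1 : ℂ) - (n + 1) = -n by ring] at hid
    push_cast
    rw [zero_sub]
    linear_combination -hid

lemma F_E_pow_succ_apply {v : X} (h : X.H v = 0) (n : ℕ) :
    X.F ((X.E ^ (n + 1)) v) =
      (X.E ^ n) (X.E (X.F v) + (qN r (n + 1) * qN r (-n)) • v) := by
  have h' : X.H v = (0 : ℂ) • v := by rw [h, zero_smul]
  induction n with
  | zero => simpa [qN, qn_zero, eq_comm] using E_F_pow_succ_apply X h 0
  | succ n ih =>
    have hw := H_E_pow_apply X h' (n + 1)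
    have hid := qN_mul_identity r (n + 1) 0
    have e := E_F_apply X ((X.E ^ (n + 1)) v)
    rw [pow_succ', Module.End.mul_apply, eq_sub_of_add_eq e.symm, ih, X.K_weight _ _ hw,
      Kinv_apply_of_weight X hw, ← sub_smul, ← qn, smul_smul]
    rw [← Module.End.mul_apply X.E, ← pow_succ', map_add, map_add, add_sub_assoc, map_smul,
      map_smul, ← sub_smul]
    congr 2
    rw [zero_sub, zero_sub, zero_add, show (1 : ℂ) - (n + 1) = -n by ring] at hid
    have hneg : qn r (-(2 * ((n : ℂ) + 1))) = - qn r (2 * ((n : ℂ) + 1)) := by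
      rw [qn, qn, neg_neg, neg_sub]
    rw [hneg] at hid
    push_cast
    rw [zero_add]
    linear_combination -hid

/-- On vectors of weight zero, `E ^ n F ^ n = F ^ n E ^ n`. -/
lemma E_pow_F_pow_apply {v : X} (h : X.H v = 0) (n : ℕ) :
    (X.E ^ n) ((X.F ^ n) v) = (X.F ^ n) ((X.E ^ n) v) := by
  induction n generalizing v with
  | zero => rfl
  | succ n ih =>
    have h' : X.H v = (0 : ℂ) • v := by rw [h, zero_smul]
    have hEF : X.E (X.F v) = X.F (X.E v) := by
      simpa [qN, qn_zero] using E_F_pow_succ_apply X h 0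
    -- With `w = F E v + [n+1][-n] v`, the two sides become `E ^ n F ^ n w` and `F ^ n E ^ n w`. As
    -- `w` again has weight zero, induction applies to it.
    rw [pow_succ X.E, Module.End.mul_apply, E_F_pow_succ_apply X h, pow_succ X.F,
      Module.End.mul_apply, ← pow_succ X.E, F_E_pow_succ_apply X h, hEF, ih]
    rw [map_add, map_smul, h, smul_zero, add_zero, H_F_apply, H_E_apply, h, map_zero, zero_add,
      map_smul, ← add_smul]
    norm_num

end WeightVectors

/-! ### The adjoint action on spaces of linear maps -/

section AdjointAction

variable {r : ℕ}

/-- The adjoint action of `E` on linear maps. -/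
def adE (X Y : WeightModule r) : Module.End ℂ (X →ₗ[ℂ] Y) where
  toFun φ := (Y.E ∘ₗ φ - φ ∘ₗ X.E) ∘ₗ X.Kinv
  map_add' φ ψ := LinearMap.ext fun x => by simp; abel
  map_smul' c φ := LinearMap.ext fun x => by simp [smul_sub]

/-- The adjoint action of `F` on linear maps. -/
def adF (X Y : WeightModule r) : Module.End ℂ (X →ₗ[ℂ] Y) where
  toFun φ := Y.F ∘ₗ φ - Y.Kinv ∘ₗ φ ∘ₗ X.K ∘ₗ X.F
  map_add' φ ψ := LinearMap.ext fun x => by simp; abel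
  map_smul' c φ := LinearMap.ext fun x => by simp [smul_sub]

variable {X Y X' Y' : WeightModule r}

lemma adE_apply (φ : X →ₗ[ℂ] Y) : adE X Y φ = (Y.E ∘ₗ φ - φ ∘ₗ X.E) ∘ₗ X.Kinv := rfl

lemma adF_apply (φ : X →ₗ[ℂ] Y) :
    adF X Y φ = Y.F ∘ₗ φ - Y.Kinv ∘ₗ φ ∘ₗ X.K ∘ₗ X.F := rfl

/-- The isomorphism `Y ⊗ X* ≃ Hom(X, Y)`. -/
noncomputable def tensorDualEquiv (X Y : WeightModule r) :
    Y ⊗[ℂ] Module.Dual ℂ X ≃ₗ[ℂ] (X →ₗ[ℂ] Y) :=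
  TensorProduct.comm ℂ Y (Module.Dual ℂ X) ≪≫ₗ dualTensorHomEquiv (R := ℂ) (M := X) (N := Y)

lemma tensorDualEquiv_tmul (y : Y) (ξ : Module.Dual ℂ X) (x : X) :
    tensorDualEquiv X Y (y ⊗ₜ ξ) x = ξ x • y := by
  simp [tensorDualEquiv]

section

variable [r.AtLeastTwo]

/-- Through this identification, nilpotency and the commutation rules of `adE` and `adF` are
inherited from the weight module `Y ⊗ X*`, with no new computation. -/
lemma tensorDualEquiv_E (z : Y ⊗[ℂ] Module.Dual ℂ X) :
    tensorDualEquiv X Y ((tensorObj Y (dualObj X)).E z) = adE X Y (tensorDualEquiv X Y z) := by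
  induction z using TensorProduct.induction_on with
  | zero => simp only [map_zero]
  | add a b ha hb => simp only [map_add, ha, hb]
  | tmul y ξ =>
    ext x
    simp [adE_apply, tensorDualEquiv_tmul, LinearMap.dualMap_apply]
    abel

lemma tensorDualEquiv_F (z : Y ⊗[ℂ] Module.Dual ℂ X) :
    tensorDualEquiv X Y ((tensorObj Y (dualObj X)).F z) = adF X Y (tensorDualEquiv X Y z) := by
  induction z using TensorProduct.induction_on with
  | zero => simp only [map_zero]
  | add a b ha hb => simp only [map_add, ha, hb]
  | tmul y ξ =>
    ext x
    simp [adF_apply, tensorDualEquiv_tmul, LinearMap.dualMap_apply]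
    abel

lemma tensorDualEquiv_H (z : Y ⊗[ℂ] Module.Dual ℂ X) :
    tensorDualEquiv X Y ((tensorObj Y (dualObj X)).H z) =
      Y.H ∘ₗ tensorDualEquiv X Y z - tensorDualEquiv X Y z ∘ₗ X.H := by
  induction z using TensorProduct.induction_on with
  | zero => simp
  | add a b ha hb =>
    simp only [map_add, ha, hb, LinearMap.comp_add, LinearMap.add_comp]; abel
  | tmul y ξ =>
    ext x
    simp [tensorDualEquiv_tmul, LinearMap.dualMap_apply]
    abel

lemma tensorDualEquiv_Kinv (z : Y ⊗[ℂ] Module.Dual ℂ X) :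
    tensorDualEquiv X Y ((tensorObj Y (dualObj X)).Kinv z) =
      Y.Kinv ∘ₗ tensorDualEquiv X Y z ∘ₗ X.K := by
  induction z using TensorProduct.induction_on with
  | zero => simp
  | add a b ha hb =>
    simp only [map_add, ha, hb, LinearMap.comp_add, LinearMap.add_comp]
  | tmul y ξ =>
    ext x
    simp [tensorDualEquiv_tmul, LinearMap.dualMap_apply]

lemma tensorDualEquiv_E_pow (z : Y ⊗[ℂ] Module.Dual ℂ X) (n : ℕ) :
    tensorDualEquiv X Y (((tensorObj Y (dualObj X)).E ^ n) z) =
      (adE X Y ^ n) (tensorDualEquiv X Y z) := by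
  induction n with
  | zero => simp
  | succ n ih =>
    rw [pow_succ', pow_succ', Module.End.mul_apply, Module.End.mul_apply, tensorDualEquiv_E, ih]

lemma tensorDualEquiv_F_pow (z : Y ⊗[ℂ] Module.Dual ℂ X) (n : ℕ) :
    tensorDualEquiv X Y (((tensorObj Y (dualObj X)).F ^ n) z) =
      (adF X Y ^ n) (tensorDualEquiv X Y z) := by
  induction n with
  | zero => simp
  | succ n ih =>
    rw [pow_succ', pow_succ', Module.End.mul_apply, Module.End.mul_apply, tensorDualEquiv_F, ih]

end

/-- The average of a linear map: the adjoint action of `E ^ (r - 1) F ^ (r - 1)`. -/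
def average (X Y : WeightModule r) : (X →ₗ[ℂ] Y) →ₗ[ℂ] (X →ₗ[ℂ] Y) :=
  adE X Y ^ (r - 1) * adF X Y ^ (r - 1)

lemma average_apply (φ : X →ₗ[ℂ] Y) :
    average X Y φ = (adE X Y ^ (r - 1)) ((adF X Y ^ (r - 1)) φ) := rfl

/-- In a weight module `K = q ^ H`, so preserving weights is enough. -/
lemma comp_K_of_comp_H {φ : X →ₗ[ℂ] Y} (h : φ ∘ₗ X.H = Y.H ∘ₗ φ) : φ ∘ₗ X.K = Y.K ∘ₗ φ := by
  obtain ⟨ι, _, _, b, μ, hH, hK, -⟩ := exists_weightBasis X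
  refine b.ext fun i => ?_
  have h1 := LinearMap.congr_fun h (b i)
  rw [LinearMap.comp_apply, LinearMap.comp_apply, hH, map_smul] at h1
  rw [LinearMap.comp_apply, LinearMap.comp_apply, hK, map_smul, Y.K_weight _ _ h1.symm]

section

variable [r.AtLeastTwo]

/-- Commuting with `H` is weight zero in `Y ⊗ X*`, where `E_pow_F_pow_apply` holds. This order of
the factors makes invariance under `F` visible, and it is the one that the adjoint of an average
produces. -/
lemma average_eq_swap {φ : X →ₗ[ℂ] Y} (h : φ ∘ₗ X.H = Y.H ∘ₗ φ) :
    average X Y φ = (adF X Y ^ (r - 1)) ((adE X Y ^ (r - 1)) φ) := by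
  obtain ⟨z, rfl⟩ := (tensorDualEquiv X Y).surjective φ
  have hz : (tensorObj Y (dualObj X)).H z = 0 := by
    apply (tensorDualEquiv X Y).injective
    rw [tensorDualEquiv_H, h, sub_self, map_zero]
  rw [average_apply, ← tensorDualEquiv_F_pow, ← tensorDualEquiv_E_pow, ← tensorDualEquiv_E_pow,
    ← tensorDualEquiv_F_pow, E_pow_F_pow_apply _ hz]

lemma adE_average (φ : X →ₗ[ℂ] Y) : adE X Y (average X Y φ) = 0 := by
  have hr := Nat.AtLeastTwo.prop (n := r)
  obtain ⟨z, rfl⟩ := (tensorDualEquiv X Y).surjective φ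
  rw [average_apply, ← tensorDualEquiv_F_pow, ← tensorDualEquiv_E_pow, ← tensorDualEquiv_E,
    ← Module.End.mul_apply, ← pow_succ', Nat.sub_add_cancel (by omega),
    (tensorObj Y (dualObj X)).E_pow, LinearMap.zero_apply, map_zero]

lemma adF_average {φ : X →ₗ[ℂ] Y} (h : φ ∘ₗ X.H = Y.H ∘ₗ φ) :
    adF X Y (average X Y φ) = 0 := by
  have hr := Nat.AtLeastTwo.prop (n := r)
  rw [average_eq_swap h]
  obtain ⟨z, rfl⟩ := (tensorDualEquiv X Y).surjective φ
  rw [← tensorDualEquiv_E_pow, ← tensorDualEquiv_F_pow, ← tensorDualEquiv_F,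
    ← Module.End.mul_apply, ← pow_succ', Nat.sub_add_cancel (by omega),
    (tensorObj Y (dualObj X)).F_pow, LinearMap.zero_apply, map_zero]

lemma average_comp_H {φ : X →ₗ[ℂ] Y} (h : φ ∘ₗ X.H = Y.H ∘ₗ φ) :
    average X Y φ ∘ₗ X.H = Y.H ∘ₗ average X Y φ := by
  obtain ⟨z, rfl⟩ := (tensorDualEquiv X Y).surjective φ
  have hz : (tensorObj Y (dualObj X)).H z = (0 : ℂ) • z := by
    apply (tensorDualEquiv X Y).injective
    rw [tensorDualEquiv_H, h, sub_self, zero_smul, map_zero]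
  have := H_E_pow_apply _ (H_F_pow_apply _ hz (r - 1)) (r - 1)
  rw [sub_add_cancel, zero_smul] at this
  rw [eq_comm, ← sub_eq_zero, average_apply, ← tensorDualEquiv_F_pow, ← tensorDualEquiv_E_pow,
    ← tensorDualEquiv_H, this, map_zero]

/-- The average of a linear map that preserves weights is a morphism. -/
def averageHom (φ : X →ₗ[ℂ] Y) (h : φ ∘ₗ X.H = Y.H ∘ₗ φ) : X ⟶ Y :=
  homMk (average X Y φ)
    (by
      -- Composition with `K` removes the factor `K⁻¹` of the adjoint action, and `E ψ = ψ E`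
      -- remains.
      have h1 := adE_average φ
      rw [adE_apply] at h1
      have h2 := congrArg (· ∘ₗ X.K) h1
      simp only [LinearMap.comp_assoc, LinearMap.zero_comp] at h2
      rw [← Module.End.mul_eq_comp X.Kinv, X.Kinv_mul_K, Module.End.one_eq_id, LinearMap.comp_id,
        sub_eq_zero] at h2
      exact h2.symm)
    (by
      -- The average preserves weights, so `K⁻¹ ψ K F = ψ F`, and vanishing of the adjoint action of
      -- `F` says `F ψ = ψ F`.
      have h1 := adF_average h
      have hK := comp_K_of_comp_H (average_comp_H h)
      rw [adF_apply, ← LinearMap.comp_assoc _ _ (average X Y φ), hK, ← LinearMap.comp_assoc,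
        ← LinearMap.comp_assoc, ← Module.End.mul_eq_comp Y.Kinv, Y.Kinv_mul_K,
        Module.End.one_eq_id, LinearMap.id_comp, sub_eq_zero] at h1
      exact h1.symm)
    (average_comp_H h) (comp_K_of_comp_H (average_comp_H h))

lemma toLin_averageHom (φ : X →ₗ[ℂ] Y) (h : φ ∘ₗ X.H = Y.H ∘ₗ φ) :
    toLin (averageHom φ h) = average X Y φ := rfl

end

/-! ### Naturality of the average -/

lemma adE_comp (g : Y ⟶ Y') (φ : X →ₗ[ℂ] Y) :
    adE X Y' (toLin g ∘ₗ φ) = toLin g ∘ₗ adE X Y φ := by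
  ext x; simp [adE_apply, toLin_E]

lemma adF_comp (g : Y ⟶ Y') (φ : X →ₗ[ℂ] Y) :
    adF X Y' (toLin g ∘ₗ φ) = toLin g ∘ₗ adF X Y φ := by
  ext x; simp [adF_apply, toLin_F, toLin_Kinv]

lemma adE_comp_right (g : X' ⟶ X) (φ : X →ₗ[ℂ] Y) :
    adE X' Y (φ ∘ₗ toLin g) = adE X Y φ ∘ₗ toLin g := by
  ext x; simp [adE_apply, toLin_E, toLin_Kinv]

lemma adF_comp_right (g : X' ⟶ X) (φ : X →ₗ[ℂ] Y) :
    adF X' Y (φ ∘ₗ toLin g) = adF X Y φ ∘ₗ toLin g := by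
  ext x; simp [adF_apply, toLin_F, toLin_K]

/-- A linear map that intertwines the adjoint actions intertwines the averages. -/
lemma average_intertwine (L : (X →ₗ[ℂ] Y) →ₗ[ℂ] (X' →ₗ[ℂ] Y'))
    (hE : ∀ φ, adE X' Y' (L φ) = L (adE X Y φ)) (hF : ∀ φ, adF X' Y' (L φ) = L (adF X Y φ))
    (φ : X →ₗ[ℂ] Y) : average X' Y' (L φ) = L (average X Y φ) := by
  have h1 : ∀ n φ, (adE X' Y' ^ n) (L φ) = L ((adE X Y ^ n) φ) := by
    intro n
    induction n with
    | zero => intro φ; rfl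
    | succ n ih => intro φ; rw [pow_succ, pow_succ, Module.End.mul_apply, hE, ih]; rfl
  have h2 : ∀ n φ, (adF X' Y' ^ n) (L φ) = L ((adF X Y ^ n) φ) := by
    intro n
    induction n with
    | zero => intro φ; rfl
    | succ n ih => intro φ; rw [pow_succ, pow_succ, Module.End.mul_apply, hF, ih]; rfl
  rw [average_apply, average_apply, h2, h1]

lemma average_comp (g : Y ⟶ Y') (φ : X →ₗ[ℂ] Y) :
    average X Y' (toLin g ∘ₗ φ) = toLin g ∘ₗ average X Y φ :=
  average_intertwine (LinearMap.llcomp ℂ X Y Y' (toLin g)) (adE_comp g) (adF_comp g) φ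

lemma average_comp_right (g : X' ⟶ X) (φ : X →ₗ[ℂ] Y) :
    average X' Y (φ ∘ₗ toLin g) = average X Y φ ∘ₗ toLin g :=
  average_intertwine ((LinearMap.llcomp ℂ X' X Y).flip (toLin g)) (adE_comp_right g)
    (adF_comp_right g) φ

end AdjointAction

/-! ### The partial trace of linear maps -/

/-- The trace of a linear map composed with `K ^ (1 - r)`. -/
noncomputable def quantumTrace {r : ℕ} (X : WeightModule r) : Module.End ℂ X →ₗ[ℂ] ℂ :=
  LinearMap.trace ℂ X ∘ₗ LinearMap.mulLeft ℂ (X.Kinv ^ (r - 1))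

lemma quantumTrace_apply {r : ℕ} (X : WeightModule r) (φ : Module.End ℂ X) :
    quantumTrace X φ = LinearMap.trace ℂ X (X.Kinv ^ (r - 1) * φ) := rfl

section LinearPartialTrace

variable {r : ℕ} [r.AtLeastTwo]

/-- The right partial trace of a linear endomorphism of `U ⊗ W`. -/
noncomputable def partialTrace (U W : WeightModule r) :
    Module.End ℂ (U ⊗[ℂ] W) →ₗ[ℂ] Module.End ℂ U where
  toFun ψ := (TensorProduct.rid ℂ U).toLinearMap ∘ₗ
    TensorProduct.map LinearMap.id (toLin (evR W)) ∘ₗ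
    (TensorProduct.assoc ℂ U W (Module.Dual ℂ W)).toLinearMap ∘ₗ
    TensorProduct.map ψ LinearMap.id ∘ₗ
    (TensorProduct.assoc ℂ U W (Module.Dual ℂ W)).symm.toLinearMap ∘ₗ
    TensorProduct.map LinearMap.id (coevaluation ℂ W) ∘ₗ
    (TensorProduct.rid ℂ U).symm.toLinearMap
  map_add' φ ψ := by
    simp only [TensorProduct.map_add_left, LinearMap.add_comp, LinearMap.comp_add]
  map_smul' c φ := by
    simp only [TensorProduct.map_smul_left, LinearMap.smul_comp, LinearMap.comp_smul,
      RingHom.id_apply]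

lemma toLin_ptrR (U W : WeightModule r) (f : tensorObj U W ⟶ tensorObj U W) :
    toLin (ptrR U W f) = partialTrace U W (toLin f) := rfl

/-- The power `K ^ (1 - r)` comes from the right evaluation. By `end_tensor_induction` this formula
determines the partial trace. -/
lemma partialTrace_map (U W : WeightModule r) (A : Module.End ℂ U) (B : Module.End ℂ W) :
    partialTrace U W (TensorProduct.map A B) =
      LinearMap.trace ℂ W (W.Kinv ^ (r - 1) * B) • A := by
  classical
  let b := Module.Basis.ofVectorSpace ℂ W
  ext u
  rw [LinearMap.trace_eq_matrix_trace ℂ b, Matrix.trace]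
  simp only [partialTrace, LinearMap.coe_mk, AddHom.coe_mk, LinearMap.comp_apply,
    LinearEquiv.coe_coe, TensorProduct.rid_symm_apply, TensorProduct.map_tmul, LinearMap.id_apply,
    coevaluation_apply_one, TensorProduct.tmul_sum, map_sum, TensorProduct.assoc_symm_tmul,
    TensorProduct.assoc_tmul, TensorProduct.rid_tmul, LinearMap.smul_apply,
    ← Finset.sum_smul]
  congr 1
  refine Finset.sum_congr rfl fun i _ => ?_
  rw [Matrix.diag_apply, LinearMap.toMatrix_apply]
  rfl

lemma end_tensor_induction {V W : Type} [AddCommGroup V] [Module ℂ V] [FiniteDimensional ℂ V]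
    [AddCommGroup W] [Module ℂ W] [FiniteDimensional ℂ W] {p : Module.End ℂ (V ⊗[ℂ] W) → Prop}
    (h0 : p 0) (hadd : ∀ φ ψ, p φ → p ψ → p (φ + ψ))
    (hmap : ∀ A B, p (TensorProduct.map A B)) (ψ : Module.End ℂ (V ⊗[ℂ] W)) : p ψ := by
  obtain ⟨z, rfl⟩ := (homTensorHomEquiv ℂ V W V W).surjective ψ
  induction z using TensorProduct.induction_on with
  | zero => rwa [map_zero]
  | add a b ha hb => rw [map_add]; exact hadd _ _ ha hb
  | tmul A B =>
    rw [homTensorHomEquiv_apply]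
    exact hmap A B

lemma adE_map (U W : WeightModule r) (A : Module.End ℂ U) (B : Module.End ℂ W) :
    adE (tensorObj U W) (tensorObj U W) (TensorProduct.map A B) =
      TensorProduct.map (A * U.Kinv) (W.E * B * W.Kinv) -
      TensorProduct.map (A * U.Kinv) (B * W.E * W.Kinv) +
      TensorProduct.map (U.E * A * U.Kinv) (W.K * B * W.Kinv) -
      TensorProduct.map (A * U.E * U.Kinv) B := by
  refine TensorProduct.ext' fun u w => ?_
  have h : W.K (W.Kinv w) = w := LinearMap.congr_fun W.K_mul_Kinv w
  rw [adE_apply (X := tensorObj U W) (Y := tensorObj U W)]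
  simp [h]
  abel

lemma adF_map (U W : WeightModule r) (A : Module.End ℂ U) (B : Module.End ℂ W) :
    adF (tensorObj U W) (tensorObj U W) (TensorProduct.map A B) =
      TensorProduct.map (U.Kinv * A) (W.F * B) -
      TensorProduct.map (U.Kinv * A) (W.Kinv * B * W.K * W.F) +
      TensorProduct.map (U.F * A) B -
      TensorProduct.map (U.Kinv * A * U.K * U.F) (W.Kinv * B * W.K) := by
  refine TensorProduct.ext' fun u w => ?_
  have h : U.K (U.Kinv u) = u := LinearMap.congr_fun U.K_mul_Kinv u
  rw [adF_apply (X := tensorObj U W) (Y := tensorObj U W)]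
  simp [h]
  abel

/-- On `A ⊗ B` the terms in which `E` acts on `W` cancel after the weighted trace: cyclicity reduces
this to `E` commuting with `K ^ (-r)`, which holds as `q ^ (2 r) = 1`. In the other terms,
conjugating `B` by `K` leaves the weighted trace unchanged. -/
lemma adE_partialTrace (U W : WeightModule r) (ψ : Module.End ℂ (U ⊗[ℂ] W)) :
    adE U U (partialTrace U W ψ) =
      partialTrace U W (adE (tensorObj U W) (tensorObj U W) ψ) := by
  induction ψ using end_tensor_induction with
  | h0 => simp only [map_zero]
  | hadd φ ψ hφ hψ => simp only [map_add, hφ, hψ]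
  | hmap A B =>
    have hc : W.Kinv * W.Kinv ^ (r - 1) = W.Kinv ^ (r - 1) * W.Kinv :=
      (pow_succ' _ _).symm.trans (pow_succ _ _)
    have h1 : LinearMap.trace ℂ W (W.Kinv ^ (r - 1) * (W.E * B * W.Kinv)) =
        LinearMap.trace ℂ W (W.Kinv ^ (r - 1) * (B * W.E * W.Kinv)) := by
      rw [← mul_assoc, LinearMap.trace_mul_comm, mul_assoc B, ← mul_assoc _ B,
        LinearMap.trace_mul_comm ℂ (_ * B), ← mul_assoc (W.E * W.Kinv), ← Kinv_pow_mul_E]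
      simp only [← mul_assoc, hc]
    have h2 : LinearMap.trace ℂ W (W.Kinv ^ (r - 1) * (W.K * B * W.Kinv)) =
        LinearMap.trace ℂ W (W.Kinv ^ (r - 1) * B) := by
      rw [← mul_assoc, LinearMap.trace_mul_comm, ← mul_assoc, ← mul_assoc, hc,
        mul_assoc (W.Kinv ^ (r - 1)), W.Kinv_mul_K, mul_one]
    rw [adE_map, map_sub, map_add, map_sub, partialTrace_map, partialTrace_map, partialTrace_map,
      partialTrace_map, partialTrace_map, h1, h2, map_smul, sub_self, zero_add, ← smul_sub]
    rfl

lemma adF_partialTrace (U W : WeightModule r) (ψ : Module.End ℂ (U ⊗[ℂ] W)) :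
    adF U U (partialTrace U W ψ) =
      partialTrace U W (adF (tensorObj U W) (tensorObj U W) ψ) := by
  induction ψ using end_tensor_induction with
  | h0 => simp only [map_zero]
  | hadd φ ψ hφ hψ => simp only [map_add, hφ, hψ]
  | hmap A B =>
    have hc : W.Kinv * W.Kinv ^ (r - 1) = W.Kinv ^ (r - 1) * W.Kinv :=
      (pow_succ' _ _).symm.trans (pow_succ _ _)
    have h1 : LinearMap.trace ℂ W (W.Kinv ^ (r - 1) * (W.F * B)) =
        LinearMap.trace ℂ W (W.Kinv ^ (r - 1) * (W.Kinv * B * W.K * W.F)) := by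
      rw [mul_assoc _ W.K, ← mul_assoc _ (_ * B), LinearMap.trace_mul_comm ℂ (_ * (_ * B)),
        ← mul_assoc _ W.Kinv, ← mul_assoc (W.K * W.F), ← Kinv_pow_mul_F, mul_assoc]
    have h2 : LinearMap.trace ℂ W (W.Kinv ^ (r - 1) * (W.Kinv * B * W.K)) =
        LinearMap.trace ℂ W (W.Kinv ^ (r - 1) * B) := by
      rw [← mul_assoc, LinearMap.trace_mul_comm, ← mul_assoc, ← mul_assoc, mul_assoc W.K, ← hc,
        ← mul_assoc W.K, W.K_mul_Kinv, one_mul]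
    rw [adF_map, map_sub, map_add, map_sub, partialTrace_map, partialTrace_map, partialTrace_map,
      partialTrace_map, partialTrace_map, h1, h2, map_smul, sub_self, zero_add, ← smul_sub]
    rfl

lemma average_partialTrace (U W : WeightModule r) (ψ : Module.End ℂ (U ⊗[ℂ] W)) :
    average U U (partialTrace U W ψ) =
      partialTrace U W (average (tensorObj U W) (tensorObj U W) ψ) :=
  average_intertwine (X := tensorObj U W) (Y := tensorObj U W) (partialTrace U W)
    (adE_partialTrace U W) (adF_partialTrace U W) ψ

lemma adE_map_one (U W : WeightModule r) (A : Module.End ℂ U) :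
    adE (tensorObj U W) (tensorObj U W) (TensorProduct.map A 1) =
      TensorProduct.map (adE U U A) 1 := by
  refine TensorProduct.ext' fun u w => ?_
  have h : W.K (W.Kinv w) = w := LinearMap.congr_fun W.K_mul_Kinv w
  rw [adE_apply (X := tensorObj U W) (Y := tensorObj U W), adE_apply]
  simp [h, TensorProduct.sub_tmul]

lemma adF_map_one (U W : WeightModule r) (A : Module.End ℂ U) :
    adF (tensorObj U W) (tensorObj U W) (TensorProduct.map A 1) =
      TensorProduct.map (adF U U A) 1 := by
  refine TensorProduct.ext' fun u w => ?_
  have h : W.Kinv (W.K w) = w := LinearMap.congr_fun W.Kinv_mul_K w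
  have h' : W.Kinv (W.K (W.F w)) = W.F w := LinearMap.congr_fun W.Kinv_mul_K _
  have h'' : U.K (U.Kinv u) = u := LinearMap.congr_fun U.K_mul_Kinv u
  rw [adF_apply (X := tensorObj U W) (Y := tensorObj U W), adF_apply]
  simp [h, h', h'', TensorProduct.sub_tmul]

/-- This carries the property `IsAveraged` from `U` to `U ⊗ W`. -/
lemma average_map_one (U W : WeightModule r) (A : Module.End ℂ U) :
    average (tensorObj U W) (tensorObj U W) (TensorProduct.map A 1) =
      TensorProduct.map (average U U A) 1 :=
  average_intertwine (X' := tensorObj U W) (Y' := tensorObj U W)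
    ((TensorProduct.mapBilinear (RingHom.id ℂ) U W U W).flip 1) (adE_map_one U W) (adF_map_one U W) A

/-- Since `K` is grouplike, `K ^ (1 - r)` acts on `U ⊗ W` as a tensor product, and the trace is
multiplicative. -/
lemma quantumTrace_partialTrace (U W : WeightModule r) (ψ : Module.End ℂ (U ⊗[ℂ] W)) :
    quantumTrace U (partialTrace U W ψ) = quantumTrace (tensorObj U W) ψ := by
  induction ψ using end_tensor_induction with
  | h0 => simp only [map_zero]
  | hadd φ ψ hφ hψ => simp only [map_add, hφ, hψ]
  | hmap A B =>
    rw [partialTrace_map, map_smul, quantumTrace_apply, quantumTrace_apply]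
    change _ = LinearMap.trace ℂ (U ⊗[ℂ] W) ((TensorProduct.map U.Kinv W.Kinv) ^ (r - 1) *
      TensorProduct.map A B)
    rw [TensorProduct.map_pow, ← TensorProduct.map_mul, LinearMap.trace_tensorProduct', smul_eq_mul,
      mul_comm]

end LinearPartialTrace

/-! ### Explicit formulas for the average -/

section ProductFormula

open Polynomial in
/-- If `a` and `b` commute and `ω` is a primitive `r`-th root of unity, then
`∏_{k < r - 1} (a - ω ^ k b) = ∑_{j < r} ω ^ (-j) a ^ (r - 1 - j) b ^ j`. -/
lemma prod_sub_smul_eq_sum {A : Type} [Ring A] [Algebra ℂ A] {a b : A} (hab : Commute a b)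
    {ω : ℂ} {r : ℕ} (hr : r ≠ 0) (hω : IsPrimitiveRoot ω r) (P : ℕ → A) (h0 : P 0 = 1)
    (hs : ∀ n, P (n + 1) = (a - ω ^ n • b) * P n) :
    P (r - 1) = ∑ j ∈ Finset.range r, ω⁻¹ ^ j • (a ^ (r - 1 - j) * b ^ j) := by
  have hcomm : ∀ p : ℂ[X], Commute (aeval a p) b := fun p => by
    induction p using Polynomial.induction_on' with
    | add p q hp hq => rw [map_add]; exact hp.add_left hq
    | monomial n c =>
      rw [aeval_monomial]
      exact (Algebra.commute_algebraMap_left c b).mul_left (hab.pow_left n)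
  -- The identity is proved in the polynomial ring in two variables, a domain in which a factor can
  -- be cancelled, and then specialized: the inner variable `C X` goes to `a`, the outer variable
  -- `X` to `b`.
  let Φ : ℂ[X][X] →+* A := eval₂RingHom' (aeval a : ℂ[X] →ₐ[ℂ] A).toRingHom b hcomm
  have hΦa : Φ (C X) = a := by
    change eval₂ _ _ _ = _
    rw [eval₂_C]; simp
  have hΦb : Φ X = b := by
    change eval₂ _ _ _ = _
    rw [eval₂_X]
  have hΦc : ∀ c : ℂ, Φ (C (C c)) = algebraMap ℂ A c := fun c => by
    change eval₂ _ _ _ = _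
    rw [eval₂_C]; simp
  let ζ : ℂ[X][X] := C (C ω)
  have hζ : IsPrimitiveRoot ζ r :=
    hω.map_of_injective (f := (C : ℂ[X] →+* ℂ[X][X]).comp C)
      ((C_injective (R := ℂ[X])).comp C_injective)
  have hP : ∀ n, P n = Φ (∏ k ∈ Finset.range n, (C X - ζ ^ k * X)) := fun n => by
    induction n with
    | zero => simp [h0]
    | succ n ih =>
      rw [hs, ih, Finset.prod_range_succ, mul_comm, map_mul, map_sub, map_mul, map_pow, hΦa, hΦb,
        hΦc, ← map_pow, ← Algebra.smul_def]
  have hset : Finset.image (ζ ^ ·) (Finset.range r) = nthRootsFinset r (1 : ℂ[X][X]) := by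
    refine Finset.eq_of_subset_of_card_le (fun x hx => ?_) ?_
    · obtain ⟨k, -, rfl⟩ := Finset.mem_image.mp hx
      rw [mem_nthRootsFinset (by omega), ← pow_mul, mul_comm, pow_mul, hζ.pow_eq_one, one_pow]
    · rw [hζ.card_nthRootsFinset, Finset.card_image_of_injOn, Finset.card_range]
      intro i hi j hj hij
      exact hζ.pow_inj (Finset.mem_range.mp hi) (Finset.mem_range.mp hj) hij
  have hfull : ∏ k ∈ Finset.range r, (C X - ζ ^ k * X) = (C X : ℂ[X][X]) ^ r - X ^ r := by
    rw [hζ.pow_sub_pow_eq_prod_sub_mul _ _ (by omega), ← hset, Finset.prod_image]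
    intro i hi j hj hij
    exact hζ.pow_inj (Finset.mem_range.mp hi) (Finset.mem_range.mp hj) hij
  let η : ℂ[X][X] := C (C ω⁻¹)
  have hω0 : ω ≠ 0 := hω.ne_zero hr
  have hηζ : η = ζ ^ (r - 1) := by
    simp only [η, ζ, ← map_pow]
    congr 2
    refine inv_eq_of_mul_eq_one_left ?_
    rw [← pow_succ, Nat.sub_add_cancel (by omega), hω.pow_eq_one]
  have hne : (C X - η * X : ℂ[X][X]) ≠ 0 := by
    intro h
    have := congrArg (fun p => coeff (coeff p 0) 1) h
    simp at this
  -- The full product over `k < r` is `a ^ r - b ^ r`. The missing factor is `a - ω ^ (r - 1) b = a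
  -- - ω⁻¹ b`, and since `(ω⁻¹ b) ^ r = b ^ r` the quotient is a geometric sum.
  have hprod : ∏ k ∈ Finset.range (r - 1), (C X - ζ ^ k * X) =
      ∑ j ∈ Finset.range r, (C X : ℂ[X][X]) ^ (r - 1 - j) * (η * X) ^ j := by
    refine mul_right_cancel₀ hne ?_
    have h1 := hfull
    rw [show r = r - 1 + 1 by omega, Finset.prod_range_succ, ← hηζ] at h1
    rw [h1, Nat.sub_add_cancel (by omega), mul_comm]
    have h2 := Commute.mul_geom_sum₂ (Commute.all (η * X : ℂ[X][X]) (C X)) r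
    have h3 : (η * X : ℂ[X][X]) ^ r = X ^ r := by
      rw [mul_pow, hηζ, ← pow_mul, mul_comm (r - 1), pow_mul, hζ.pow_eq_one, one_pow, one_mul]
    rw [h3] at h2
    simp only [mul_comm ((η * X : ℂ[X][X]) ^ _)] at h2
    linear_combination h2
  rw [hP, hprod, map_sum]
  refine Finset.sum_congr rfl fun j _ => ?_
  rw [map_mul, map_pow, map_pow, map_mul, hΦa, hΦb, hΦc, ← Algebra.smul_def, _root_.smul_pow,
    mul_smul_comm]

end ProductFormula

/-! ### Powers of the adjoint action of `E` and `F` -/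

section AverageFormula

variable {r : ℕ} {X Y : WeightModule r}

/-- Composition with `A` on the left. -/
def compLeft (X : WeightModule r) (A : Module.End ℂ Y) : Module.End ℂ (X →ₗ[ℂ] Y) where
  toFun φ := A ∘ₗ φ
  map_add' φ ψ := LinearMap.comp_add φ ψ A
  map_smul' c φ := LinearMap.comp_smul A c φ

/-- Composition with `A` on the right. -/
def compRight (Y : WeightModule r) (A : Module.End ℂ X) : Module.End ℂ (X →ₗ[ℂ] Y) where
  toFun φ := φ ∘ₗ A
  map_add' φ ψ := LinearMap.add_comp A ψ φ
  map_smul' c φ := LinearMap.smul_comp c φ A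

lemma compLeft_pow (A : Module.End ℂ Y) (n : ℕ) (φ : X →ₗ[ℂ] Y) :
    (compLeft X A ^ n) φ = (A ^ n) ∘ₗ φ := by
  induction n with
  | zero => rfl
  | succ n ih => rw [pow_succ', pow_succ', Module.End.mul_apply, ih]; rfl

lemma compRight_pow (A : Module.End ℂ X) (n : ℕ) (φ : X →ₗ[ℂ] Y) :
    (compRight Y A ^ n) φ = φ ∘ₗ (A ^ n) := by
  induction n with
  | zero => rfl
  | succ n ih => rw [pow_succ', pow_succ, Module.End.mul_apply, ih]; rfl

lemma Kinv_pow_mul_E_pow (X : WeightModule r) (m n : ℕ) :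
    X.Kinv ^ m * X.E ^ n = qpow r (-2) ^ (m * n) • (X.E ^ n * X.Kinv ^ m) := by
  have h1 : ∀ m : ℕ, X.Kinv ^ m * X.E = qpow r (-2) ^ m • (X.E * X.Kinv ^ m) := by
    intro m
    induction m with
    | zero => simp
    | succ m ih =>
      rw [pow_succ, mul_assoc, Kinv_mul_E, mul_smul_comm, ← mul_assoc, ih, smul_mul_assoc,
        smul_smul, mul_assoc, ← pow_succ, ← pow_succ']
  induction n with
  | zero => simp
  | succ n ih =>
    rw [pow_succ X.E, ← mul_assoc, ih, smul_mul_assoc, mul_assoc, h1, mul_smul_comm, smul_smul,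
      ← mul_assoc, ← pow_add]
    rfl

lemma qpow_neg_two_isPrimitiveRoot (hr : r ≠ 0) : IsPrimitiveRoot (qpow r (-2)) r := by
  have h := (qpow_two_isPrimitiveRoot r hr).inv
  rwa [inv_eq_of_mul_eq_one_right (qpow_mul_neg r 2)] at h

variable [r.AtLeastTwo]

/-- After all factors `K⁻¹` are moved to the right, the `n`-th application of `adE` (counted from 0)
contributes `L_E - q ^ (-2 n) R_E`, with `L_E` and `R_E` the commuting left and right compositions
with `E`. The product formula applies with `ω = q ^ (-2)`. -/
lemma adE_pow_apply (φ : X →ₗ[ℂ] Y) :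
    (adE X Y ^ (r - 1)) φ = ∑ j ∈ Finset.range r,
      qpow r 2 ^ j • ((Y.E ^ (r - 1 - j)) ∘ₗ φ ∘ₗ (X.E ^ j) ∘ₗ (X.Kinv ^ (r - 1))) := by
  have hr := Nat.AtLeastTwo.prop (n := r)
  let P : ℕ → Module.End ℂ (X →ₗ[ℂ] Y) := fun n => Nat.rec 1
    (fun n p => (compLeft X Y.E - qpow r (-2) ^ n • compRight Y X.E) * p) n
  have key : ∀ n, (adE X Y ^ n) φ = P n φ ∘ₗ (X.Kinv ^ n) := by
    intro n
    induction n with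
    | zero => rfl
    | succ n ih =>
      have h1 : (X.Kinv ^ n) ∘ₗ X.E = qpow r (-2) ^ n • (X.E ∘ₗ (X.Kinv ^ n)) := by
        have h := Kinv_pow_mul_E_pow X n 1
        rwa [mul_one, pow_one] at h
      rw [pow_succ', Module.End.mul_apply, ih, adE_apply, LinearMap.comp_assoc _ _ (P n φ), h1,
        pow_succ X.Kinv]
      ext x
      simp [P, compLeft, compRight]
  rw [key, prod_sub_smul_eq_sum (a := compLeft X Y.E) (b := compRight Y X.E) (by rfl)
    (by omega) (qpow_neg_two_isPrimitiveRoot (r := r) (by omega)) P rfl fun _ => rfl]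
  refine LinearMap.ext fun x => ?_
  rw [LinearMap.comp_apply, LinearMap.sum_apply, LinearMap.sum_apply, LinearMap.sum_apply]
  refine Finset.sum_congr rfl fun j _ => ?_
  rw [LinearMap.smul_apply, Module.End.mul_apply, compRight_pow, compLeft_pow,
    inv_eq_of_mul_eq_one_right (qpow_neg_mul r 2)]
  rfl

/-- Each application of `adF` multiplies the eigenvalue of `φ ↦ K⁻¹ φ K` by `q ^ 2`, so the factors
are `L_F - q ^ (2 n) c R_F`. The value `c = 1` serves weight-preserving maps; `c = q ^ 2` is needed
after `adE ^ (r - 1)`. -/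
lemma adF_pow_apply {φ : X →ₗ[ℂ] Y} {c : ℂ} (h : Y.Kinv ∘ₗ φ ∘ₗ X.K = c • φ) :
    (adF X Y ^ (r - 1)) φ = ∑ j ∈ Finset.range r,
      (qpow r (-2) * c) ^ j • ((Y.F ^ (r - 1 - j)) ∘ₗ φ ∘ₗ (X.F ^ j)) := by
  have hr := Nat.AtLeastTwo.prop (n := r)
  let P : ℕ → Module.End ℂ (X →ₗ[ℂ] Y) := fun n => Nat.rec 1
    (fun n p => (compLeft X Y.F - qpow r 2 ^ n • (c • compRight Y X.F)) * p) n
  have key : ∀ n, (adF X Y ^ n) φ = P n φ ∧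
      Y.Kinv ∘ₗ P n φ ∘ₗ X.K = (qpow r 2 ^ n * c) • P n φ := by
    intro n
    induction n with
    | zero => exact ⟨rfl, by simpa [P] using h⟩
    | succ n ih =>
      obtain ⟨ih, hn⟩ := ih
      have hx : ∀ x, Y.Kinv (P n φ (X.K x)) = (qpow r 2 ^ n * c) • P n φ x :=
        LinearMap.congr_fun hn
      have hF : ∀ x, X.F (X.K x) = qpow r 2 • X.K (X.F x) := fun x => by
        have := LinearMap.congr_fun (K_mul_F X) x
        simp only [Module.End.mul_apply, LinearMap.smul_apply] at this
        rw [this, smul_smul, qpow_mul_neg, one_smul]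
      have hF' : ∀ y, Y.Kinv (Y.F y) = qpow r 2 • Y.F (Y.Kinv y) :=
        LinearMap.congr_fun (Kinv_mul_F Y)
      constructor
      · rw [pow_succ', Module.End.mul_apply, ih, adF_apply]
        ext x
        simp [P, compLeft, compRight, smul_smul] at hx ⊢
        rw [hx]
      · ext x
        simp [P, compLeft, compRight, smul_smul] at hx ⊢
        simp only [hF, hF', map_smul, hx, smul_sub, smul_smul]
        congr 2 <;> ring
  have hc : Commute (compLeft X Y.F) (c • compRight Y X.F) :=
    Commute.smul_right (show Commute (compLeft X Y.F) (compRight Y X.F) from rfl) c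
  rw [(key _).1, prod_sub_smul_eq_sum hc
    (by omega) (qpow_two_isPrimitiveRoot r (by omega)) P rfl fun _ => rfl]
  rw [LinearMap.sum_apply]
  refine Finset.sum_congr rfl fun j _ => ?_
  rw [LinearMap.smul_apply, Module.End.mul_apply, smul_pow, LinearMap.smul_apply, compRight_pow,
    map_smul, compLeft_pow, inv_eq_of_mul_eq_one_right (qpow_mul_neg r 2), smul_smul, mul_pow]

end AverageFormula

/-! ### The average on `V_α` -/

section ValphaAverage

/-- The basis vectors of `V_α`. -/
def Valpha.vec (r : ℕ) [r.AtLeastTwo] (α : ℂ) (n : ℕ) : Valpha r α := stdVec r n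

/-- The basis of `V_α`. -/
noncomputable def Valpha.basis (r : ℕ) [r.AtLeastTwo] (α : ℂ) :
    Module.Basis (Fin r) ℂ (Valpha r α) := Pi.basisFun ℂ (Fin r)

variable {r : ℕ} [r.AtLeastTwo] {α : ℂ}

namespace Valpha

lemma basis_apply (i : Fin r) : basis r α i = vec r α i := basisFun_eq r i

lemma F_vec (n : ℕ) : (Valpha r α).F (vec r α n) = vec r α (n + 1) := by
  change stdOp r (fun _ => 1) (· + 1) (stdVec r n) = stdVec r (n + 1)
  rw [stdOp_stdVec r _ _ n fun h => by rw [stdVec_of_le r (by omega), smul_zero], one_smul]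

lemma H_vec (n : ℕ) : (Valpha r α).H (vec r α n) = (α + r - 1 - 2 * n) • vec r α n := by
  change stdOp r (fun n => α + r - 1 - 2 * n) id (stdVec r n) = (α + r - 1 - 2 * n) • stdVec r n
  exact stdOp_stdVec r _ _ n fun h => by simp [stdVec_of_le r h]

lemma E_vec {n : ℕ} (hn : n < r) :
    (Valpha r α).E (vec r α n) = (qN r n * qN r (n - α)) • vec r α (n - 1) := by
  rw [Valpha_E]
  exact stdOp_stdVec r _ _ n fun h => absurd hn (by omega)

lemma F_pow_vec (n k : ℕ) : ((Valpha r α).F ^ k) (vec r α n) = vec r α (n + k) := by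
  induction k with
  | zero => rfl
  | succ k ih => rw [pow_succ', Module.End.mul_apply, ih, F_vec]; rfl

lemma E_pow_vec {n : ℕ} (hn : n < r) : ((Valpha r α).E ^ n) (vec r α n) =
    (∏ k ∈ Finset.range n, (qN r (k + 1 : ℕ) * qN r ((k + 1 : ℕ) - α))) • vec r α 0 := by
  induction n with
  | zero => simp
  | succ n ih =>
    rw [pow_succ, Module.End.mul_apply, E_vec hn, Nat.add_sub_cancel, map_smul, ih (by omega),
      smul_smul, Finset.prod_range_succ, mul_comm]

/-- The scalar `∏_{0 < k < r} [k] [k - α]`. -/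
noncomputable def scalar (r : ℕ) (α : ℂ) : ℂ :=
  ∏ k ∈ Finset.range (r - 1), (qN r (k + 1 : ℕ) * qN r ((k + 1 : ℕ) - α))

/-- The weights of `V_α` are pairwise distinct, so a weight-preserving map is diagonal. -/
lemma apply_vec_of_comp_H {ρ : Module.End ℂ (Valpha r α)}
    (h : ρ ∘ₗ (Valpha r α).H = (Valpha r α).H ∘ₗ ρ) (i : Fin r) :
    ρ (basis r α i) = (basis r α).repr (ρ (basis r α i)) i • basis r α i := by
  have h1 := LinearMap.congr_fun h (basis r α i)
  rw [LinearMap.comp_apply, LinearMap.comp_apply, basis_apply, H_vec, map_smul,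
    ← basis_apply] at h1
  set w := ρ (basis r α i)
  have h2 : ∀ k, (basis r α).repr ((Valpha r α).H w) k =
      (α + r - 1 - 2 * (k : ℕ)) * (basis r α).repr w k := by
    intro k
    have : (basis r α).coord k ∘ₗ (Valpha r α).H =
        (α + r - 1 - 2 * (k : ℕ)) • (basis r α).coord k := by
      refine (basis r α).ext fun j => ?_
      rw [LinearMap.comp_apply, basis_apply, H_vec, ← basis_apply]
      rcases eq_or_ne j k with rfl | hjk
      · simp
      · simp [hjk]
    exact LinearMap.congr_fun this w
  apply (basis r α).repr.injective
  ext k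
  rcases eq_or_ne i k with rfl | hik
  · simp
  · have h3 := h2 k
    rw [← h1, map_smul, Finsupp.smul_apply, smul_eq_mul, ← sub_eq_zero, ← sub_mul] at h3
    rcases mul_eq_zero.mp h3 with h4 | h4
    · exfalso
      apply hik
      have : ((k : ℕ) : ℂ) = (i : ℕ) := by linear_combination h4 / 2
      exact Fin.ext (Nat.cast_injective this).symm
    · simp [h4, hik]

lemma qpow_two_pow_sub_one : qpow r 2 ^ (r - 1) = qpow r (-2) := by
  have hr := Nat.AtLeastTwo.prop (n := r)
  have h : qpow r 2 ^ (r - 1) * qpow r 2 = 1 := by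
    rw [← pow_succ, Nat.sub_add_cancel (by omega),
      (qpow_two_isPrimitiveRoot r (by omega)).pow_eq_one]
  calc qpow r 2 ^ (r - 1) = qpow r 2 ^ (r - 1) * (qpow r 2 * qpow r (-2)) := by
        rw [qpow_mul_neg, mul_one]
    _ = _ := by rw [← mul_assoc, h, one_mul]

lemma Kinv_pow_vec (n k : ℕ) : ((Valpha r α).Kinv ^ k) (vec r α n) =
    qpow r (-(α + r - 1 - 2 * n)) ^ k • vec r α n := by
  induction k with
  | zero => simp
  | succ k ih =>
    rw [pow_succ', Module.End.mul_apply, ih, map_smul, Kinv_apply_of_weight _ (H_vec n), smul_smul,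
      ← pow_succ]

lemma quantumTrace_eq {ρ : Module.End ℂ (Valpha r α)}
    (h : ρ ∘ₗ (Valpha r α).H = (Valpha r α).H ∘ₗ ρ) :
    quantumTrace (Valpha r α) ρ = qpow r (-(α + r - 1)) ^ (r - 1) *
      ∑ i : Fin r, qpow r (-2) ^ (i : ℕ) * (basis r α).repr (ρ (basis r α i)) i := by
  rw [quantumTrace_apply, LinearMap.trace_eq_matrix_trace ℂ (basis r α), Matrix.trace,
    Finset.mul_sum]
  refine Finset.sum_congr rfl fun i _ => ?_
  rw [Matrix.diag_apply, LinearMap.toMatrix_apply, Module.End.mul_apply]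
  conv_lhs => rw [apply_vec_of_comp_H h i, map_smul, basis_apply, Kinv_pow_vec, ← basis_apply]
  -- The `(r - 1)`-st power of `q ^ (2 i)` is `q ^ (-2 i)`, because `q ^ (2 r) = 1`.
  have e : qpow r (-(α + r - 1 - 2 * (i : ℕ))) = qpow r (-(α + r - 1)) * qpow r 2 ^ (i : ℕ) := by
    rw [← qpow_nat_mul, ← qpow_add]; congr 1; ring
  rw [e, mul_pow, pow_right_comm, qpow_two_pow_sub_one]
  simp
  ring

/-- On `V_α` the average of `ρ` is the scalar `∏ [k] [k - α]` times the quantum trace of `ρ`. -/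
lemma average_eq {ρ : Module.End ℂ (Valpha r α)}
    (h : ρ ∘ₗ (Valpha r α).H = (Valpha r α).H ∘ₗ ρ) :
    average (Valpha r α) (Valpha r α) ρ =
      (scalar r α * quantumTrace (Valpha r α) ρ) • LinearMap.id := by
  have hr := Nat.AtLeastTwo.prop (n := r)
  -- The average commutes with `F`, and `v_0` generates `V_α` under `F`; its value on `v_0`
  -- therefore determines it.
  have h0 : average (Valpha r α) (Valpha r α) ρ (vec r α 0) =
      (scalar r α * quantumTrace (Valpha r α) ρ) • vec r α 0 := by
    have hw : (Valpha r α).Kinv ∘ₗ ρ ∘ₗ (Valpha r α).K = (1 : ℂ) • ρ := by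
      rw [comp_K_of_comp_H h]
      change (Valpha r α).Kinv * ((Valpha r α).K * ρ) = _
      rw [← mul_assoc, (Valpha r α).Kinv_mul_K, one_mul, one_smul]
    have hE0 : (Valpha r α).E (vec r α 0) = 0 := by
      rw [E_vec (by omega)]; simp [qN, qn_zero]
    have hψ : ((adF (Valpha r α) (Valpha r α) ^ (r - 1)) ρ) (vec r α 0) =
        (∑ i : Fin r, qpow r (-2) ^ (i : ℕ) * (basis r α).repr (ρ (basis r α i)) i) •
          vec r α (r - 1) := by
      rw [adF_pow_apply hw, LinearMap.sum_apply, Finset.sum_range, Finset.sum_smul]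
      refine Finset.sum_congr rfl fun i _ => ?_
      rw [LinearMap.smul_apply, LinearMap.comp_apply, LinearMap.comp_apply, F_pow_vec, zero_add,
        ← basis_apply, apply_vec_of_comp_H h i, map_smul]
      rw [basis_apply, F_pow_vec, smul_smul, mul_one, show (i : ℕ) + (r - 1 - i) = r - 1 by omega]
      simp [← basis_apply]
    -- Only the term without `E` on the right survives, since `E v_0 = 0`. There `adF ^ (r - 1)`
    -- sends `v_0` to a multiple of `v_{r-1}`, and `E ^ (r - 1)` brings this back to `v_0` with the
    -- factor `scalar r α`.
    rw [average_apply, adE_pow_apply, LinearMap.sum_apply, Finset.sum_eq_single_of_mem 0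
      (Finset.mem_range.mpr (by omega))]
    · simp only [pow_zero, one_smul, Nat.sub_zero, LinearMap.comp_apply, Module.End.one_apply]
      rw [Kinv_pow_vec, map_smul, hψ, map_smul, map_smul, E_pow_vec (by omega), smul_smul,
        smul_smul, quantumTrace_eq h, scalar, Nat.cast_zero, mul_zero, sub_zero]
      congr 1
      ring
    · intro i _ hi
      obtain ⟨j, rfl⟩ := Nat.exists_eq_succ_of_ne_zero hi
      rw [LinearMap.smul_apply, LinearMap.comp_apply, LinearMap.comp_apply, LinearMap.comp_apply,
        Kinv_pow_vec, map_smul, Nat.succ_eq_add_one, pow_succ (Valpha r α).E j,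
        Module.End.mul_apply, hE0]
      simp
  refine (basis r α).ext fun i => ?_
  have hF : ∀ n, average (Valpha r α) (Valpha r α) ρ (vec r α n) =
      (scalar r α * quantumTrace (Valpha r α) ρ) • vec r α n := by
    intro n
    induction n with
    | zero => exact h0
    | succ n ih =>
      rw [← F_vec, ← toLin_averageHom ρ h, toLin_F, toLin_averageHom, ih, map_smul]
  rw [basis_apply, hF, LinearMap.smul_apply, LinearMap.id_apply]

end Valpha

end ValphaAverage

/-! ### Vanishing and reality of quantum integers -/

section QuantumIntegers

variable {r : ℕ}

lemma exists_int_of_qn_eq_zero (hr : r ≠ 0) {x : ℂ} (h : qn r x = 0) : ∃ n : ℤ, x = n * r := by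
  have hr' : (r : ℂ) ≠ 0 := by exact_mod_cast hr
  have hpi : (Real.pi : ℂ) ≠ 0 := by exact_mod_cast Real.pi_ne_zero
  rw [qn, sub_eq_zero, qpow, qpow, Complex.exp_eq_exp_iff_exists_int] at h
  obtain ⟨n, hn⟩ := h
  refine ⟨n, ?_⟩
  have h2 : (2 * Real.pi * Complex.I) * x = (2 * Real.pi * Complex.I) * (n * r) := by
    field_simp at hn
    linear_combination Real.pi * Complex.I * hn
  exact mul_left_cancel₀ Complex.two_pi_I_ne_zero h2

lemma conj_qpow (x : ℂ) : conj (qpow r x) = qpow r (-conj x) := by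
  rw [qpow, qpow, ← Complex.exp_conj]
  congr 1
  simp

/-- Conjugation inverts `q`, as `|q| = 1`. The sign cancels in quotients, so `[x]` and `{α} / {r α}`
are real for real arguments. -/
lemma conj_qn (x : ℂ) : conj (qn r x) = - qn r (conj x) := by
  rw [qn, map_sub, conj_qpow, conj_qpow, qn, map_neg, neg_neg, neg_sub]

lemma conj_qN (x : ℂ) : conj (qN r x) = qN r (conj x) := by
  rw [qN, map_div₀, conj_qn, conj_qn, map_one, neg_div_neg_eq, qN]

lemma conj_scalar {α : ℂ} (h : conj α = α) :
    conj (Valpha.scalar r α) = Valpha.scalar r α := by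
  rw [Valpha.scalar, map_prod]
  refine Finset.prod_congr rfl fun k _ => ?_
  rw [map_mul, conj_qN, conj_qN, map_sub, h, map_natCast]

lemma qn_one_ne_zero (hr : 2 ≤ r) : qn r 1 ≠ 0 := by
  intro h
  obtain ⟨n, hn⟩ := exists_int_of_qn_eq_zero (by omega) h
  have h1 : (1 : ℤ) = n * r := by exact_mod_cast hn
  have : (r : ℤ) ∣ 1 := ⟨n, by rw [h1]; ring⟩
  have := Int.le_of_dvd one_pos this
  omega

lemma scalar_ne_zero (hr : 2 ≤ r) {α : ℂ} (h : ∀ n : ℤ, α ≠ n) : Valpha.scalar r α ≠ 0 := by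
  rw [Valpha.scalar, Finset.prod_ne_zero_iff]
  intro k hk
  have hk := Finset.mem_range.mp hk
  refine mul_ne_zero (div_ne_zero (fun h0 => ?_) (qn_one_ne_zero hr))
    (div_ne_zero (fun h0 => ?_) (qn_one_ne_zero hr))
  · obtain ⟨n, hn⟩ := exists_int_of_qn_eq_zero (by omega) h0
    have h1 : ((k + 1 : ℕ) : ℤ) = n * r := by exact_mod_cast hn
    have : (r : ℤ) ∣ (k + 1 : ℕ) := ⟨n, by rw [h1]; ring⟩
    have := Int.le_of_dvd (by positivity) this
    omega
  · obtain ⟨n, hn⟩ := exists_int_of_qn_eq_zero (by omega) h0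
    apply h ((k + 1 : ℕ) - n * r)
    push_cast at hn ⊢
    linear_combination -hn

end QuantumIntegers

/-! ### Adjoints of linear maps -/

namespace HermitianStructure

variable {r : ℕ} {X : WeightModule r} (h : HermitianStructure X)

/-- The adjoint of a linear endomorphism of a Hermitian module. -/
noncomputable def adj (φ : Module.End ℂ X) : Module.End ℂ X where
  toFun w := h.repr (h.form w ∘ₗ φ)
  map_add' w w' := h.form_injective fun v => by simp [form_repr]
  map_smul' c w := h.form_injective fun v => by simp [form_repr]

lemma form_adj (φ : Module.End ℂ X) (w v : X) : h.form (h.adj φ w) v = h.form w (φ v) :=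
  h.form_repr _ _

lemma adj_eq_of_form {φ ψ : Module.End ℂ X} (hψ : ∀ w v, h.form (ψ w) v = h.form w (φ v)) :
    h.adj φ = ψ :=
  LinearMap.ext fun w => h.form_injective fun v => by rw [form_adj, hψ]

lemma adj_one : h.adj 1 = 1 := h.adj_eq_of_form fun _ _ => rfl

lemma adj_mul (φ ψ : Module.End ℂ X) : h.adj (φ * ψ) = h.adj ψ * h.adj φ :=
  h.adj_eq_of_form fun w v => by simp [form_adj]

lemma adj_add (φ ψ : Module.End ℂ X) : h.adj (φ + ψ) = h.adj φ + h.adj ψ :=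
  h.adj_eq_of_form fun w v => by simp [form_adj]

lemma adj_zero : h.adj 0 = 0 :=
  h.adj_eq_of_form fun w v => by simp

lemma adj_smul (c : ℂ) (φ : Module.End ℂ X) : h.adj (c • φ) = conj c • h.adj φ :=
  h.adj_eq_of_form fun w v => by simp [form_adj]

lemma adj_sum {ι : Type} (s : Finset ι) (φ : ι → Module.End ℂ X) :
    h.adj (∑ i ∈ s, φ i) = ∑ i ∈ s, h.adj (φ i) :=
  h.adj_eq_of_form fun w v => by simp [form_adj, LinearMap.sum_apply]

lemma adj_pow (φ : Module.End ℂ X) (n : ℕ) : h.adj (φ ^ n) = h.adj φ ^ n := by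
  induction n with
  | zero => exact h.adj_one
  | succ n ih => rw [pow_succ, adj_mul, ih, ← pow_succ']

lemma adj_E : h.adj X.E = X.F := h.adj_eq_of_form h.form_E

lemma adj_F : h.adj X.F = X.E := h.adj_eq_of_form h.form_F

lemma adj_H : h.adj X.H = X.H := h.adj_eq_of_form h.form_H

lemma adj_Kinv : h.adj X.Kinv = X.K := h.adj_eq_of_form h.form_Kinv

lemma trace_adj (φ : Module.End ℂ X) :
    LinearMap.trace ℂ X (h.adj φ) = conj (LinearMap.trace ℂ X φ) := by
  obtain ⟨z, rfl⟩ := (dualTensorHomEquiv (R := ℂ) (M := X) (N := X)).surjective φ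
  induction z using TensorProduct.induction_on with
  | zero => rw [map_zero, adj_zero, map_zero, map_zero]
  | add a b ha hb => rw [map_add, adj_add, map_add, map_add, ha, hb, map_add]
  | tmul ξ y =>
    -- The adjoint of the rank-one map `v ↦ ξ(v) y` is `w ↦ (y, w) u`, where `u` represents `ξ`; the
    -- two traces `ξ(y) = (u, y)` and `(y, u)` are conjugate.
    have hadj : h.adj (dualTensorHom ℂ X X (ξ ⊗ₜ y)) =
        dualTensorHom ℂ X X (h.form y ⊗ₜ h.repr ξ) :=
      h.adj_eq_of_form fun w v => by
        rw [dualTensorHom_apply, dualTensorHom_apply, LinearMap.map_smulₛₗ, LinearMap.smul_apply,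
          form_repr, map_smul, h.symm w y, smul_eq_mul, smul_eq_mul, mul_comm]
    have e : dualTensorHomEquiv (R := ℂ) (M := X) (N := X) (ξ ⊗ₜ y) =
        dualTensorHom ℂ X X (ξ ⊗ₜ y) := by simp
    rw [e, hadj, LinearMap.trace_eq_contract_apply, LinearMap.trace_eq_contract_apply,
      contractLeft_apply, contractLeft_apply, h.symm, form_repr]

lemma adj_comp_H {φ : Module.End ℂ X} (hφ : φ ∘ₗ X.H = X.H ∘ₗ φ) :
    h.adj φ ∘ₗ X.H = X.H ∘ₗ h.adj φ := by
  have := congrArg h.adj (show φ * X.H = X.H * φ from hφ)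
  rw [adj_mul, adj_mul, adj_H] at this
  exact this.symm

end HermitianStructure

/-! ### The adjoint of an average -/

section AdjointAverage

variable {r : ℕ}

lemma K_pow_mul_E_pow (X : WeightModule r) (m n : ℕ) :
    X.K ^ m * X.E ^ n = qpow r 2 ^ (m * n) • (X.E ^ n * X.K ^ m) := by
  have h1 : ∀ m : ℕ, X.K ^ m * X.E = qpow r 2 ^ m • (X.E * X.K ^ m) := by
    intro m
    induction m with
    | zero => simp
    | succ m ih =>
      rw [pow_succ, mul_assoc, K_mul_E, mul_smul_comm, ← mul_assoc, ih, smul_mul_assoc,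
        smul_smul, mul_assoc, ← pow_succ, ← pow_succ']
  induction n with
  | zero => simp
  | succ n ih =>
    rw [pow_succ X.E, ← mul_assoc, ih, smul_mul_assoc, mul_assoc, h1, mul_smul_comm, smul_smul,
      ← mul_assoc, ← pow_add]
    rfl

lemma K_pow_mul_F_pow (X : WeightModule r) (m n : ℕ) :
    X.K ^ m * X.F ^ n = qpow r (-2) ^ (m * n) • (X.F ^ n * X.K ^ m) := by
  have h1 : ∀ m : ℕ, X.K ^ m * X.F = qpow r (-2) ^ m • (X.F * X.K ^ m) := by
    intro m
    induction m with
    | zero => simp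
    | succ m ih =>
      rw [pow_succ, mul_assoc, K_mul_F, mul_smul_comm, ← mul_assoc, ih, smul_mul_assoc,
        smul_smul, mul_assoc, ← pow_succ, ← pow_succ']
  induction n with
  | zero => simp
  | succ n ih =>
    rw [pow_succ X.F, ← mul_assoc, ih, smul_mul_assoc, mul_assoc, h1, mul_smul_comm, smul_smul,
      ← mul_assoc, ← pow_add]
    rfl

variable [r.AtLeastTwo] {X : WeightModule r}

lemma average_eq_sum {φ : Module.End ℂ X} (hφ : φ ∘ₗ X.H = X.H ∘ₗ φ) :
    average X X φ = ∑ i ∈ Finset.range r, ∑ j ∈ Finset.range r,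
      (qpow r 2 ^ i * qpow r (-2) ^ j) •
        (X.E ^ (r - 1 - i) * X.F ^ (r - 1 - j) * φ * X.F ^ j * X.E ^ i * X.Kinv ^ (r - 1)) := by
  have hw : X.Kinv ∘ₗ φ ∘ₗ X.K = (1 : ℂ) • φ := by
    rw [comp_K_of_comp_H hφ]
    change X.Kinv * (X.K * φ) = _
    rw [← mul_assoc, X.Kinv_mul_K, one_mul, one_smul]
  rw [average_apply, adE_pow_apply, adF_pow_apply hw]
  refine Finset.sum_congr rfl fun i _ => ?_
  simp only [← Module.End.mul_eq_comp, Finset.sum_mul, Finset.mul_sum, Finset.smul_sum,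
    smul_mul_assoc, mul_smul_comm, smul_smul, mul_one, ← mul_assoc]

/-- Taking adjoints turns words with `E` outside and `F` inside into words with `F` outside and `E`
inside; this expansion is the one to compare with. -/
lemma average_eq_sum_swap {φ : Module.End ℂ X} (hφ : φ ∘ₗ X.H = X.H ∘ₗ φ) :
    average X X φ = ∑ i ∈ Finset.range r, ∑ j ∈ Finset.range r,
      (qpow r 2 ^ j) •
        (X.F ^ (r - 1 - i) * X.E ^ (r - 1 - j) * φ * X.E ^ j * X.Kinv ^ (r - 1) * X.F ^ i) := by
  have hw : X.Kinv ∘ₗ ((adE X X ^ (r - 1)) φ) ∘ₗ X.K = qpow r 2 • (adE X X ^ (r - 1)) φ := by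
    obtain ⟨z, rfl⟩ := (tensorDualEquiv X X).surjective φ
    have hz : (tensorObj X (dualObj X)).H z = (0 : ℂ) • z := by
      apply (tensorDualEquiv X X).injective
      rw [tensorDualEquiv_H, hφ, sub_self, zero_smul, map_zero]
    have h1 := Kinv_apply_of_weight _ (H_E_pow_apply _ hz (r - 1))
    -- The map `adE ^ (r - 1) φ` has weight `2 (r - 1)`, and `q ^ (-2 (r - 1)) = q ^ 2`. This
    -- cancels the `q ^ (-2)` of `adF_pow_apply`.
    have h2 : qpow r (-(0 + 2 * ((r - 1 : ℕ) : ℂ))) = qpow r 2 := by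
      have hr := Nat.AtLeastTwo.prop (n := r)
      have h3 : qpow r 2 ^ (r - 1) * qpow r 2 = 1 := by
        rw [← pow_succ, Nat.sub_add_cancel (by omega),
          (qpow_two_isPrimitiveRoot r (by omega)).pow_eq_one]
      rw [← qpow_nat_mul] at h3
      calc qpow r (-(0 + 2 * ((r - 1 : ℕ) : ℂ)))
          = qpow r (-(((r - 1 : ℕ) : ℂ) * 2)) * (qpow r (((r - 1 : ℕ) : ℂ) * 2) * qpow r 2) := by
            rw [h3, mul_one]; congr 1; ring
        _ = qpow r 2 := by rw [← mul_assoc, qpow_neg_mul, one_mul]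
    rw [← tensorDualEquiv_E_pow, ← tensorDualEquiv_Kinv, h1, map_smul, h2]
  rw [average_eq_swap hφ, adF_pow_apply hw, adE_pow_apply, qpow_neg_mul]
  refine Finset.sum_congr rfl fun i _ => ?_
  simp only [← Module.End.mul_eq_comp, Finset.sum_mul, Finset.mul_sum, one_pow, one_smul,
    smul_mul_assoc, mul_smul_comm, ← mul_assoc]

/-- The adjoint of an average is an average. -/
lemma adj_average (h : HermitianStructure X) {φ : Module.End ℂ X}
    (hφ : φ ∘ₗ X.H = X.H ∘ₗ φ) :
    h.adj (average X X φ) = average X X (h.adj φ * X.K ^ (r - 1 + (r - 1))) := by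
  have hr := Nat.AtLeastTwo.prop (n := r)
  have hHK : Commute X.H (X.K ^ (r - 1 + (r - 1))) :=
    Commute.pow_right (show Commute X.H X.K from X.H_K) _
  have hψ : (h.adj φ * X.K ^ (r - 1 + (r - 1))) ∘ₗ X.H =
      X.H ∘ₗ (h.adj φ * X.K ^ (r - 1 + (r - 1))) := by
    change (h.adj φ * X.K ^ (r - 1 + (r - 1))) * X.H = X.H * (h.adj φ * _)
    rw [mul_assoc, ← hHK.eq, ← mul_assoc, ← mul_assoc]
    congr 1
    exact h.adj_comp_H hφ
  have hKφ : h.adj φ * X.K = X.K * h.adj φ := comp_K_of_comp_H (h.adj_comp_H hφ)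
  have hKφ' : X.K ^ (r - 1) * h.adj φ = h.adj φ * X.K ^ (r - 1) :=
    (Commute.pow_right (show Commute (h.adj φ) X.K from hKφ) _).eq.symm
  have hKK : X.K ^ (r - 1) * X.Kinv ^ (r - 1) = 1 := by
    rw [← (show Commute X.K X.Kinv from X.K_mul_Kinv.trans X.Kinv_mul_K.symm).mul_pow,
      X.K_mul_Kinv, one_pow]
  have hq2 : ∀ k : ℕ, qpow r 2 ^ k * qpow r 2 ^ ((r - 1) * k) = 1 := fun k => by
    rw [← pow_add, show k + (r - 1) * k = r * k by
      obtain ⟨n, rfl⟩ : ∃ n, r = n + 1 := ⟨r - 1, by omega⟩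
      simp; ring, pow_mul, (qpow_two_isPrimitiveRoot r (by omega)).pow_eq_one, one_pow]
  have hq2' : ∀ k : ℕ, qpow r (-2) ^ k * qpow r (-2) ^ ((r - 1) * k) = 1 := fun k => by
    rw [← pow_add, show k + (r - 1) * k = r * k by
      obtain ⟨n, rfl⟩ : ∃ n, r = n + 1 := ⟨r - 1, by omega⟩
      simp; ring, pow_mul, (qpow_neg_two_isPrimitiveRoot (r := r) (by omega)).pow_eq_one, one_pow]
  have hc2 : conj (qpow r 2) = qpow r (-2) := by rw [conj_qpow, Complex.conj_ofNat]
  have hc2' : conj (qpow r (-2)) = qpow r 2 := by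
    rw [conj_qpow, map_neg, Complex.conj_ofNat, neg_neg]
  -- The double sums agree term by term after both indices of the first are reflected. Taking
  -- adjoints puts `K ^ (r - 1)` on the left; it and the factors of `K ^ (2 (r - 1))` in the second
  -- sum are moved to the right of `φ†`. The resulting powers of `q` cancel every coefficient, by `q
  -- ^ (2 r) = 1`.
  rw [average_eq_sum hφ, average_eq_sum_swap hψ, h.adj_sum, ← Finset.sum_range_reflect]
  refine Finset.sum_congr rfl fun i hi => ?_
  have hi := Finset.mem_range.mp hi
  rw [h.adj_sum, ← Finset.sum_range_reflect]
  refine Finset.sum_congr rfl fun j hj => ?_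
  have hj := Finset.mem_range.mp hj
  rw [show r - 1 - (r - 1 - i) = i by omega, show r - 1 - (r - 1 - j) = j by omega]
  rw [h.adj_smul, h.adj_mul, h.adj_mul, h.adj_mul, h.adj_mul, h.adj_mul, h.adj_pow, h.adj_pow,
    h.adj_pow, h.adj_pow, h.adj_pow, h.adj_E, h.adj_F, h.adj_Kinv, map_mul, map_pow, map_pow, hc2,
    hc2']
  have hl : X.K ^ (r - 1) * (X.F ^ (r - 1 - i) * (X.E ^ (r - 1 - j) * (h.adj φ *
      (X.E ^ j * X.F ^ i)))) =
      (qpow r (-2) ^ ((r - 1) * (r - 1 - i)) * qpow r 2 ^ ((r - 1) * (r - 1 - j))) •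
      (X.F ^ (r - 1 - i) * X.E ^ (r - 1 - j) * h.adj φ * X.K ^ (r - 1) * X.E ^ j * X.F ^ i) := by
    rw [← mul_assoc, K_pow_mul_F_pow, smul_mul_assoc, mul_assoc, ← mul_assoc (X.K ^ _),
      K_pow_mul_E_pow, smul_mul_assoc, mul_smul_comm, mul_assoc, ← mul_assoc (X.K ^ _), hKφ',
      smul_smul]
    simp only [mul_assoc]
  have hrt : X.K ^ (r - 1 + (r - 1)) * X.E ^ j * X.Kinv ^ (r - 1) =
      qpow r 2 ^ ((r - 1) * j) • (X.K ^ (r - 1) * X.E ^ j) := by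
    conv_lhs => rw [pow_add, mul_assoc _ _ (X.E ^ j), K_pow_mul_E_pow, mul_smul_comm,
      smul_mul_assoc, ← mul_assoc, mul_assoc _ (X.K ^ _) (X.Kinv ^ _), hKK, mul_one]
  have e2 : X.F ^ (r - 1 - i) * X.E ^ (r - 1 - j) * (h.adj φ * X.K ^ (r - 1 + (r - 1))) *
      X.E ^ j * X.Kinv ^ (r - 1) * X.F ^ i = X.F ^ (r - 1 - i) * X.E ^ (r - 1 - j) * h.adj φ *
      (X.K ^ (r - 1 + (r - 1)) * X.E ^ j * X.Kinv ^ (r - 1)) * X.F ^ i := by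
    simp only [mul_assoc]
  rw [e2, hrt, mul_smul_comm, smul_mul_assoc, smul_smul, hq2, one_smul, hl, smul_smul,
    mul_mul_mul_comm, hq2', hq2, mul_one, one_smul]
  simp only [mul_assoc]

end AdjointAverage

/-- By cyclicity the left side is the trace of `φ† K ^ (r - 1) = (K ^ (1 - r) φ)†`. Thus the factor
`K ^ (2 (r - 1))` from `adj_average` is the one that compensates for `K† = K⁻¹`. -/
lemma quantumTrace_adj {r : ℕ} {X : WeightModule r} (h : HermitianStructure X)
    (φ : Module.End ℂ X) :
    quantumTrace X (h.adj φ * X.K ^ (r - 1 + (r - 1))) = conj (quantumTrace X φ) := by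
  have hKK : X.K ^ (r - 1) * X.Kinv ^ (r - 1) = 1 := by
    rw [← (show Commute X.K X.Kinv from X.K_mul_Kinv.trans X.Kinv_mul_K.symm).mul_pow,
      X.K_mul_Kinv, one_pow]
  rw [quantumTrace_apply, quantumTrace_apply, ← h.trace_adj, h.adj_mul, h.adj_pow, h.adj_Kinv,
    LinearMap.trace_mul_comm, pow_add, mul_assoc, mul_assoc, hKK, mul_one]

/-! ### Epimorphisms and projective objects -/

section Projectives

variable {r : ℕ} {X Y : WeightModule r}

lemma hom_ext {f g : X ⟶ Y} (h : toLin f = toLin g) : f = g := Subtype.ext h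

lemma toLin_comp {Z : WeightModule r} (f : X ⟶ Y) (g : Y ⟶ Z) :
    toLin (f ≫ g) = toLin g ∘ₗ toLin f := rfl

lemma toLin_id : toLin (𝟙 X) = LinearMap.id := rfl

lemma epi_of_surjective (f : X ⟶ Y) (h : Function.Surjective (toLin f)) : Epi f where
  left_cancellation g g' hg := by
    refine hom_ext (LinearMap.ext fun y => ?_)
    obtain ⟨x, rfl⟩ := h y
    exact LinearMap.congr_fun (congrArg toLin hg) x

lemma repr_H_apply {ι : Type} (b : Module.Basis ι ℂ X) {μ : ι → ℂ}
    (hH : ∀ i, X.H (b i) = μ i • b i) (w : X) (i : ι) :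
    b.repr (X.H w) i = μ i * b.repr w i := by
  have : b.coord i ∘ₗ X.H = μ i • b.coord i := by
    refine b.ext fun j => ?_
    by_cases h : j = i
    · subst h; simp [hH]
    · simp [hH, h]
  simpa using LinearMap.congr_fun this w

lemma weight_eq_of_repr_ne_zero {ι : Type} (b : Module.Basis ι ℂ X) {μ : ι → ℂ}
    (hH : ∀ i, X.H (b i) = μ i • b i) {w : X} {l : ℂ} (hw : X.H w = l • w) {i : ι}
    (hi : b.repr w i ≠ 0) : μ i = l := by
  have h := repr_H_apply b hH w i
  rw [hw, map_smul, Finsupp.smul_apply, smul_eq_mul] at h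
  exact (mul_right_cancel₀ hi h).symm

/-- The quotient of a weight module by a submodule. -/
noncomputable def quotientObj (Y : WeightModule r) (p : Submodule ℂ Y) (hE : p ≤ p.comap Y.E)
    (hF : p ≤ p.comap Y.F) (hH : p ≤ p.comap Y.H) (hK : p ≤ p.comap Y.K)
    (hKinv : p ≤ p.comap Y.Kinv) : WeightModule r where
  carrier := Y ⧸ p
  E := p.mapQ p Y.E hE
  F := p.mapQ p Y.F hF
  H := p.mapQ p Y.H hH
  K := p.mapQ p Y.K hK
  Kinv := p.mapQ p Y.Kinv hKinv
  K_mul_Kinv := Submodule.linearMap_qext _ (LinearMap.ext fun y =>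
    congrArg p.mkQ (LinearMap.congr_fun Y.K_mul_Kinv y))
  Kinv_mul_K := Submodule.linearMap_qext _ (LinearMap.ext fun y =>
    congrArg p.mkQ (LinearMap.congr_fun Y.Kinv_mul_K y))
  K_E := Submodule.linearMap_qext _ (LinearMap.ext fun y =>
    congrArg p.mkQ (LinearMap.congr_fun Y.K_E y))
  K_F := Submodule.linearMap_qext _ (LinearMap.ext fun y =>
    congrArg p.mkQ (LinearMap.congr_fun Y.K_F y))
  E_F := Submodule.linearMap_qext _ (LinearMap.ext fun y =>
    congrArg p.mkQ (LinearMap.congr_fun Y.E_F y))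
  H_K := Submodule.linearMap_qext _ (LinearMap.ext fun y =>
    congrArg p.mkQ (LinearMap.congr_fun Y.H_K y))
  H_E := Submodule.linearMap_qext _ (LinearMap.ext fun y =>
    congrArg p.mkQ (LinearMap.congr_fun Y.H_E y))
  H_F := Submodule.linearMap_qext _ (LinearMap.ext fun y =>
    congrArg p.mkQ (LinearMap.congr_fun Y.H_F y))
  E_pow := by
    refine Submodule.linearMap_qext _ (LinearMap.ext fun y => ?_)
    rw [← Submodule.mapQ_pow]
    exact congrArg p.mkQ (LinearMap.congr_fun Y.E_pow y)
  F_pow := by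
    refine Submodule.linearMap_qext _ (LinearMap.ext fun y => ?_)
    rw [← Submodule.mapQ_pow]
    exact congrArg p.mkQ (LinearMap.congr_fun Y.F_pow y)
  iSup_weightSpace := by
    obtain ⟨ι, _, _, b, μ, hb, -, -⟩ := exists_weightBasis Y
    rw [eq_top_iff, ← Submodule.range_mkQ p, LinearMap.range_eq_map, ← b.span_eq,
      Submodule.map_span, Submodule.span_le]
    rintro _ ⟨_, ⟨i, rfl⟩, rfl⟩
    refine Submodule.mem_iSup_of_mem (μ i) (Module.End.mem_eigenspace_iff.mpr ?_)
    exact congrArg p.mkQ (hb i)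
  K_weight l v hv := by
    obtain ⟨ι, _, _, b, μ, hb, hbK, -⟩ := exists_weightBasis Y
    -- The images of weight vectors span the quotient, so a basis of weight vectors can be chosen
    -- among them.
    have hs : ⊤ ≤ Submodule.span ℂ (Set.range (p.mkQ ∘ b)) := by
      rw [Set.range_comp, ← Submodule.map_span, b.span_eq, ← LinearMap.range_eq_map,
        Submodule.range_mkQ]
    have hex : ∀ i, ∃ k, p.mkQ (b k) = Module.Basis.ofSpan hs i := fun i =>
      Module.Basis.ofSpan_subset hs ⟨i, rfl⟩
    choose k hk using hex
    refine weight_of_basis (Module.Basis.ofSpan hs) (fun i => μ (k i)) (p.mapQ p Y.H hH)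
      (p.mapQ p Y.K hK) (qpow r) (fun i => ?_) (fun i => ?_) l v hv
    · rw [← hk]; exact congrArg p.mkQ (hb _)
    · rw [← hk]; exact congrArg p.mkQ (hbK _)

/-- The range is a submodule, and the projection to the cokernel, again a weight module, agrees with
zero after composition with `f`. -/
lemma surjective_of_epi (f : X ⟶ Y) [Epi f] : Function.Surjective (toLin f) := by
  let p := LinearMap.range (toLin f)
  have hmap : ∀ {A : Module.End ℂ X} {B : Module.End ℂ Y}, (∀ v, toLin f (A v) = B (toLin f v)) →
      p ≤ p.comap B := by
    rintro A B h _ ⟨x, rfl⟩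
    exact ⟨A x, h x⟩
  let Q := quotientObj Y p (hmap (toLin_E f)) (hmap (toLin_F f)) (hmap (toLin_H f))
    (hmap (toLin_K f)) (hmap (toLin_Kinv f))
  let π : Y ⟶ Q := homMk (X := Y) (Y := Q) p.mkQ rfl rfl rfl rfl
  have h : f ≫ π = f ≫ 0 := hom_ext (LinearMap.ext fun x => by
    change p.mkQ (toLin f x) = 0
    rw [Submodule.mkQ_apply, Submodule.Quotient.mk_eq_zero]
    exact ⟨x, rfl⟩)
  have hπ : π = 0 := (cancel_epi f).mp h
  have h2 : p.mkQ = 0 := congrArg toLin hπ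
  rw [← LinearMap.range_eq_top, ← Submodule.ker_mkQ (LinearMap.range (toLin f))]
  change LinearMap.ker p.mkQ = ⊤
  rw [h2, LinearMap.ker_zero]

/-- Weight modules are semisimple over `H`, so a surjection splits compatibly with weights, though
not in general as a morphism. -/
lemma exists_weight_section (e : X ⟶ Y) (he : Function.Surjective (toLin e)) :
    ∃ s : Y →ₗ[ℂ] X, s ∘ₗ Y.H = X.H ∘ₗ s ∧ toLin e ∘ₗ s = LinearMap.id := by
  obtain ⟨ι, _, _, b, μ, hb, -, -⟩ := exists_weightBasis X
  obtain ⟨κ, _, _, c, ν, hc, -, -⟩ := exists_weightBasis Y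
  have key : ∀ k, ∃ x : X, X.H x = ν k • x ∧ toLin e x = c k := by
    intro k
    obtain ⟨x, hx⟩ := he (c k)
    -- The lift is the component of weight `ν k` of an arbitrary preimage; the components of other
    -- weights contribute nothing to `c k`.
    refine ⟨∑ i, if μ i = ν k then b.repr x i • b i else 0, ?_, ?_⟩
    · rw [map_sum, Finset.smul_sum]
      refine Finset.sum_congr rfl fun i _ => ?_
      split_ifs with h
      · rw [map_smul, hb, h, smul_comm]
      · rw [map_zero, smul_zero]
    · apply c.repr.injective
      ext j
      have hw : ∀ i, c.repr (toLin e (b i)) j ≠ 0 → ν j = μ i := fun i hi =>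
        weight_eq_of_repr_ne_zero c hc (by rw [← toLin_H, hb, map_smul]) hi
      have hx' : c.repr (c k) j = ∑ i, b.repr x i * c.repr (toLin e (b i)) j := by
        rw [← hx]
        conv_lhs => rw [← b.sum_repr x, map_sum, map_sum, Finsupp.finsetSum_apply]
        exact Finset.sum_congr rfl fun i _ => by simp
      have hl : c.repr (toLin e (∑ i, if μ i = ν k then b.repr x i • b i else 0)) j =
          ∑ i, if μ i = ν k then b.repr x i * c.repr (toLin e (b i)) j else 0 := by
        rw [map_sum, map_sum, Finsupp.finsetSum_apply]
        refine Finset.sum_congr rfl fun i _ => ?_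
        split_ifs <;> simp
      rw [hl]
      by_cases hjk : ν j = ν k
      · rw [hx']
        refine Finset.sum_congr rfl fun i _ => ?_
        split_ifs with h
        · rfl
        · by_contra hne
          exact h ((hw i (fun h0 => hne (by rw [h0, mul_zero]))).symm.trans hjk)
      · have hne : k ≠ j := fun h => hjk (by rw [h])
        rw [Module.Basis.repr_self, Finsupp.single_apply, if_neg hne]
        refine Finset.sum_eq_zero fun i _ => ?_
        split_ifs with h
        · by_contra hne
          exact hjk ((hw i (fun h0 => hne (by rw [h0, mul_zero]))).trans h)
        · rfl
  choose x hx hex using key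
  refine ⟨c.constr ℂ x, c.ext fun k => ?_, c.ext fun k => ?_⟩
  · rw [LinearMap.comp_apply, LinearMap.comp_apply, hc, map_smul, c.constr_basis, hx]
  · rw [LinearMap.comp_apply, c.constr_basis, hex, LinearMap.id_apply]

/-! ### Averaged modules and projectivity -/

/-- The identity of the module is an average. -/
def IsAveraged (P : WeightModule r) : Prop :=
  ∃ φ : Module.End ℂ P, φ ∘ₗ P.H = P.H ∘ₗ φ ∧ average P P φ = LinearMap.id

lemma comp_comp_H {X Y Z : WeightModule r} {φ : X →ₗ[ℂ] Y} {ψ : Y →ₗ[ℂ] Z}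
    (hφ : φ ∘ₗ X.H = Y.H ∘ₗ φ) (hψ : ψ ∘ₗ Y.H = Z.H ∘ₗ ψ) :
    (ψ ∘ₗ φ) ∘ₗ X.H = Z.H ∘ₗ (ψ ∘ₗ φ) := by
  rw [LinearMap.comp_assoc, hφ, ← LinearMap.comp_assoc, hψ, LinearMap.comp_assoc]

lemma toLin_comp_H (f : X ⟶ Y) : toLin f ∘ₗ X.H = Y.H ∘ₗ toLin f := f.2.2.2.1

lemma IsAveraged.of_retract {P Q : WeightModule r} (hQ : IsAveraged Q) (i : P ⟶ Q) (p : Q ⟶ P)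
    (h : i ≫ p = 𝟙 P) : IsAveraged P := by
  obtain ⟨φ, hφ, hid⟩ := hQ
  refine ⟨toLin p ∘ₗ φ ∘ₗ toLin i,
    comp_comp_H (comp_comp_H (toLin_comp_H i) hφ) (toLin_comp_H p), ?_⟩
  rw [average_comp, average_comp_right, hid, LinearMap.id_comp]
  exact congrArg toLin h

variable [r.AtLeastTwo]

/-- As in Higman's criterion: with `s` a weight-preserving section of `e`, the average of `s f φ`
lifts `f`, since `e` and `f` can be taken out of the average and `φ` averages to the identity. -/
lemma IsAveraged.projective {P : WeightModule r} (hP : IsAveraged P) : Projective P where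
  factors {Z Y} f e _ := by
    obtain ⟨φ, hφ, hid⟩ := hP
    obtain ⟨s, hs, hes⟩ := exists_weight_section e (surjective_of_epi e)
    have hw := comp_comp_H (comp_comp_H hφ (toLin_comp_H f)) hs
    refine ⟨averageHom (s ∘ₗ toLin f ∘ₗ φ) hw, hom_ext ?_⟩
    rw [toLin_comp, toLin_averageHom, ← average_comp, ← LinearMap.comp_assoc, hes,
      LinearMap.id_comp, average_comp, hid, LinearMap.comp_id]

lemma IsAveraged.tensor {U : WeightModule r} (hU : IsAveraged U) (W : WeightModule r) :
    IsAveraged (tensorObj U W) := by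
  obtain ⟨φ, hφ, hid⟩ := hU
  refine ⟨TensorProduct.map φ 1, TensorProduct.ext' fun u w => ?_, ?_⟩
  · have := LinearMap.congr_fun hφ u
    rw [LinearMap.comp_apply, LinearMap.comp_apply] at this
    simp [this]
  · rw [average_map_one, hid]
    exact TensorProduct.map_id

/-- The projection to the highest weight line has nonzero quantum trace, so by `Valpha.average_eq`
its average is a nonzero scalar. -/
lemma Valpha.isAveraged {α : ℂ} (hα : scalar r α ≠ 0) : IsAveraged (Valpha r α) := by
  have hr := Nat.AtLeastTwo.prop (n := r)
  let i₀ : Fin r := ⟨0, by omega⟩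
  let ρ : Module.End ℂ (Valpha r α) := ((basis r α).coord i₀).smulRight (basis r α i₀)
  have hρ : ∀ i, ρ (basis r α i) = if i = i₀ then basis r α i₀ else 0 := fun i => by
    simp only [ρ, LinearMap.smulRight_apply, Module.Basis.coord_apply, Module.Basis.repr_self,
      Finsupp.single_apply]
    split_ifs <;> simp
  have hH : ∀ i : Fin r, (Valpha r α).H (basis r α i) =
      (α + r - 1 - 2 * (i : ℕ)) • basis r α i := fun i => by rw [basis_apply, H_vec]
  have hw : ρ ∘ₗ (Valpha r α).H = (Valpha r α).H ∘ₗ ρ := by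
    refine (basis r α).ext fun i => ?_
    rw [LinearMap.comp_apply, LinearMap.comp_apply, hH, map_smul, hρ]
    split_ifs with h
    · rw [hH, h]
    · rw [smul_zero, map_zero]
  have hq : quantumTrace (Valpha r α) ρ ≠ 0 := by
    rw [quantumTrace_eq hw]
    refine mul_ne_zero (pow_ne_zero _ (qpow_ne_zero _ _)) ?_
    rw [Finset.sum_eq_single i₀ (fun i _ hi => by rw [hρ, if_neg hi]; simp) (by simp), hρ,
      if_pos rfl]
    simp [i₀]
  refine ⟨(scalar r α * quantumTrace (Valpha r α) ρ)⁻¹ • ρ, ?_, ?_⟩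
  · rw [LinearMap.smul_comp, LinearMap.comp_smul, hw]
  · rw [map_smul, average_eq hw, smul_smul, inv_mul_cancel₀ (mul_ne_zero hα hq), one_smul]

/-- The canonical morphism `ℂ ⊗ X → X`. -/
noncomputable def leftUnitorHom (X : WeightModule r) : tensorObj (unitObj r) X ⟶ X :=
  homMk (X := tensorObj (unitObj r) X) (TensorProduct.lid ℂ X).toLinearMap
    (TensorProduct.ext' fun x y => by simp)
    (TensorProduct.ext' fun x y => by simp)
    (TensorProduct.ext' fun x y => by simp)
    (TensorProduct.ext' fun x y => by simp)

/-- The morphism `V ⊗ (V* ⊗ X) → X` given by the right evaluation. -/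
noncomputable def evalHom (V X : WeightModule r) : tensorObj V (tensorObj (dualObj V) X) ⟶ X :=
  assocInv V (dualObj V) X ≫ tensorHom (evR V) (𝟙 X) ≫ leftUnitorHom X

lemma toLin_evalHom_tmul (V X : WeightModule r) (v : V) (ξ : Module.Dual ℂ V) (x : X) :
    toLin (evalHom V X) (v ⊗ₜ (ξ ⊗ₜ x)) = ξ ((V.Kinv ^ (r - 1)) v) • x := rfl

lemma evalHom_surjective (V X : WeightModule r) [Nontrivial V] :
    Function.Surjective (toLin (evalHom V X)) := by
  intro x
  obtain ⟨v, hv⟩ := exists_ne (0 : V)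
  obtain ⟨ξ, hξ⟩ := Module.Projective.exists_dual_eq_one ℂ hv
  have hKK : V.Kinv ^ (r - 1) * V.K ^ (r - 1) = 1 := by
    rw [← (show Commute V.Kinv V.K from V.Kinv_mul_K.trans V.K_mul_Kinv.symm).mul_pow,
      V.Kinv_mul_K, one_pow]
  refine ⟨((V.K ^ (r - 1)) v) ⊗ₜ (ξ ⊗ₜ x), ?_⟩
  rw [toLin_evalHom_tmul, ← Module.End.mul_apply, hKK, Module.End.one_apply, hξ, one_smul]

/-- The evaluation `V ⊗ (V* ⊗ P) → P` is surjective for `V ≠ 0`, hence splits over a projective `P`.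
-/
lemma exists_retract {V P : WeightModule r} [Nontrivial V] (hP : Projective P) :
    ∃ i : P ⟶ tensorObj V (tensorObj (dualObj V) P), i ≫ evalHom V P = 𝟙 P :=
  have := epi_of_surjective _ (evalHom_surjective V P)
  hP.factors (𝟙 P) (evalHom V P)

end Projectives

/-! ### The modified trace of an average -/

section TraceFormula

variable {r : ℕ}

lemma quantumTrace_comp_comm {X Y : WeightModule r} (f : X ⟶ Y) (φ : Y →ₗ[ℂ] X) :
    quantumTrace Y (toLin f ∘ₗ φ) = quantumTrace X (φ ∘ₗ toLin f) := by
  have h : ∀ n, (Y.Kinv ^ n) ∘ₗ toLin f = toLin f ∘ₗ (X.Kinv ^ n) := by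
    intro n
    induction n with
    | zero => rfl
    | succ n ih =>
      refine LinearMap.ext fun x => ?_
      have := LinearMap.congr_fun ih (X.Kinv x)
      rw [LinearMap.comp_apply, LinearMap.comp_apply] at this
      rw [LinearMap.comp_apply, LinearMap.comp_apply, pow_succ, pow_succ, Module.End.mul_apply,
        Module.End.mul_apply, ← toLin_Kinv, this]
  rw [quantumTrace_apply, quantumTrace_apply, Module.End.mul_eq_comp, ← LinearMap.comp_assoc, h,
    LinearMap.comp_assoc, LinearMap.trace_comp_comm', LinearMap.comp_assoc]
  rfl

/-- If the image of a weight vector `b i` has a nonzero coordinate at `c j`, both have the same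
weight, and the rank-one map `y ↦ c_j^*(y) b i` works: the trace is that coordinate times a power of
`q`. -/
lemma exists_quantumTrace_ne_zero {X Y : WeightModule r} {f : X ⟶ Y} (hf : f ≠ 0) :
    ∃ φ : Y →ₗ[ℂ] X, φ ∘ₗ Y.H = X.H ∘ₗ φ ∧ quantumTrace Y (toLin f ∘ₗ φ) ≠ 0 := by
  obtain ⟨ι, _, _, b, μ, hb, -, -⟩ := exists_weightBasis X
  obtain ⟨κ, _, _, c, ν, hc, -, hcK⟩ := exists_weightBasis Y
  obtain ⟨i, hi⟩ : ∃ i, toLin f (b i) ≠ 0 := by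
    by_contra! h
    exact hf (hom_ext (b.ext fun i => h i))
  obtain ⟨j, hj⟩ : ∃ j, c.repr (toLin f (b i)) j ≠ 0 := by
    by_contra! h
    exact hi (c.repr.injective (by rw [map_zero]; exact Finsupp.ext h))
  have hμ : ν j = μ i := weight_eq_of_repr_ne_zero c hc (by rw [← toLin_H, hb, map_smul]) hj
  refine ⟨(c.coord j).smulRight (b i), LinearMap.ext fun y => ?_, ?_⟩
  · rw [LinearMap.comp_apply, LinearMap.comp_apply, LinearMap.smulRight_apply,
      LinearMap.smulRight_apply, Module.Basis.coord_apply, Module.Basis.coord_apply,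
      repr_H_apply c hc, map_smul, hb, hμ, mul_comm, mul_smul]
  · have hK : ∀ n : ℕ, ∀ y, c.repr ((Y.Kinv ^ n) y) j = qpow r (-ν j) ^ n * c.repr y j := by
      have h1 : c.coord j ∘ₗ Y.Kinv = qpow r (-ν j) • c.coord j := by
        refine c.ext fun k => ?_
        rcases eq_or_ne k j with rfl | h
        · simp [hcK]
        · simp [hcK, h]
      intro n
      induction n with
      | zero => intro y; simp
      | succ n ih =>
        intro y
        rw [pow_succ, Module.End.mul_apply, ih, pow_succ, mul_assoc]
        congr 1
        exact LinearMap.congr_fun h1 y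
    have hcomp : Y.Kinv ^ (r - 1) * (toLin f ∘ₗ (c.coord j).smulRight (b i)) =
        dualTensorHom ℂ Y Y (c.coord j ⊗ₜ (Y.Kinv ^ (r - 1)) (toLin f (b i))) :=
      LinearMap.ext fun y => by simp
    rw [quantumTrace_apply, hcomp, LinearMap.trace_eq_contract_apply, contractLeft_apply,
      Module.Basis.coord_apply, hK]
    exact mul_ne_zero (pow_ne_zero _ (qpow_ne_zero _ _)) hj

variable [r.AtLeastTwo]

/-- The partial trace intertwines commutators with `H`, because `H` commutes with `K ^ (1 - r)` on
`W`. -/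
lemma partialTrace_comp_H (U W : WeightModule r) {ψ : Module.End ℂ (U ⊗[ℂ] W)}
    (h : ψ ∘ₗ (tensorObj U W).H = (tensorObj U W).H ∘ₗ ψ) :
    partialTrace U W ψ ∘ₗ U.H = U.H ∘ₗ partialTrace U W ψ := by
  have key : ∀ ψ : Module.End ℂ (U ⊗[ℂ] W),
      partialTrace U W (ψ * (tensorObj U W).H - (tensorObj U W).H * ψ) =
        partialTrace U W ψ * U.H - U.H * partialTrace U W ψ := by
    intro ψ
    induction ψ using end_tensor_induction with
    | h0 => simp
    | hadd φ ψ hφ hψ =>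
      rw [add_mul φ ψ, mul_add _ φ ψ, add_sub_add_comm, map_add, hφ, hψ, map_add, add_mul,
        mul_add, add_sub_add_comm]
    | hmap A B =>
      have hH : W.H * W.Kinv ^ (r - 1) = W.Kinv ^ (r - 1) * W.H :=
        (Commute.pow_right (show Commute W.H W.Kinv from H_mul_Kinv W) _).eq
      have h1 : LinearMap.trace ℂ W (W.Kinv ^ (r - 1) * (B * W.H)) =
          LinearMap.trace ℂ W (W.Kinv ^ (r - 1) * (W.H * B)) := by
        rw [← mul_assoc, LinearMap.trace_mul_comm, ← mul_assoc, hH, mul_assoc]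
      rw [mul_add, add_mul, ← TensorProduct.map_mul, ← TensorProduct.map_mul,
        ← TensorProduct.map_mul, ← TensorProduct.map_mul, mul_one, mul_one, one_mul, one_mul,
        map_sub, map_add, map_add, partialTrace_map, partialTrace_map, partialTrace_map,
        partialTrace_map, partialTrace_map, h1, add_sub_add_right_eq_sub, smul_mul_assoc,
        mul_smul_comm]
  have h1 := key ψ
  rw [show ψ * (tensorObj U W).H = (tensorObj U W).H * ψ from h, sub_self, map_zero] at h1
  exact sub_eq_zero.mp h1.symm

lemma IsAveraged.of_projective {P : WeightModule r} (hP : Projective P) : IsAveraged P := by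
  have hr := Nat.AtLeastTwo.prop (n := r)
  have hα : ∀ n : ℤ, (1 / 2 : ℂ) ≠ n := fun n hn => by
    have : (1 : ℤ) = 2 * n := by
      have h2 : (1 : ℂ) = 2 * n := by rw [← hn]; norm_num
      exact_mod_cast h2
    omega
  have : Nontrivial (Valpha r (1 / 2)) :=
    ⟨⟨Valpha.basis r (1 / 2) ⟨0, by omega⟩, 0, Module.Basis.ne_zero _ _⟩⟩
  obtain ⟨i, hi⟩ := exists_retract (V := Valpha r (1 / 2)) hP
  exact ((Valpha.isAveraged (scalar_ne_zero hr hα)).tensor _).of_retract i _ hi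

/-- Every morphism from an averaged module is an average. -/
lemma IsAveraged.exists_averageHom {P X : WeightModule r} (hP : IsAveraged P) (f : P ⟶ X) :
    ∃ (φ : P →ₗ[ℂ] X) (hφ : φ ∘ₗ P.H = X.H ∘ₗ φ), averageHom φ hφ = f := by
  obtain ⟨φ, hφ, hid⟩ := hP
  refine ⟨toLin f ∘ₗ φ, comp_comp_H hφ (toLin_comp_H f), hom_ext ?_⟩
  rw [toLin_averageHom, average_comp, hid, LinearMap.comp_id]

/-- The modified trace of the average of `φ` is a real multiple of the quantum trace of `φ`. -/
lemma ModifiedTrace.exists_tr_averageHom (t : ModifiedTrace r) {d₀ : ℝ} (ht : t.IsNormalized d₀) :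
    ∃ c : ℂ, conj c = c ∧ (d₀ ≠ 0 → c ≠ 0) ∧ ∀ (P : WeightModule r) (hP : Projective P)
      (φ : Module.End ℂ P) (hφ : φ ∘ₗ P.H = P.H ∘ₗ φ),
      t.tr P hP (averageHom φ hφ) = c * quantumTrace P φ := by
  have hr := Nat.AtLeastTwo.prop (n := r)
  have hr0 : (r : ℂ) ≠ 0 := by exact_mod_cast (show r ≠ 0 by omega)
  have hα : ∀ n : ℤ, (1 / 2 : ℂ) ≠ n := fun n hn => by
    have : (1 : ℤ) = 2 * n := by
      have h2 : (1 : ℂ) = 2 * n := by rw [← hn]; norm_num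
      exact_mod_cast h2
    omega
  have hconj : conj (1 / 2 : ℂ) = 1 / 2 := by
    rw [map_div₀, map_one, Complex.conj_ofNat]
  have hV := Valpha.isAveraged (r := r) (scalar_ne_zero hr hα)
  set V := Valpha r (1 / 2)
  have : Nontrivial V :=
    ⟨⟨Valpha.basis r (1 / 2) ⟨0, by omega⟩, 0, Module.Basis.ne_zero _ _⟩⟩
  have hd := ht (1 / 2) hα hV.projective
  -- The constant is the scalar of `V_{1/2}` times its modified dimension. Any real `α ∉ ℤ` could
  -- replace `1 / 2`: reality of `α` makes the constant real, non-integrality makes it nonzero for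
  -- `d₀ ≠ 0`.
  refine ⟨Valpha.scalar r (1 / 2) * (d₀ * qn r (1 / 2) / qn r (r * (1 / 2))), ?_, ?_, ?_⟩
  · rw [map_mul, conj_scalar hconj, map_div₀, map_mul, conj_qn, conj_qn, map_mul, hconj,
      map_natCast, Complex.conj_ofReal, mul_neg, neg_div_neg_eq]
  · intro hd0
    refine mul_ne_zero (scalar_ne_zero hr hα)
      (div_ne_zero (mul_ne_zero (by exact_mod_cast hd0) fun h => ?_) fun h => ?_)
    · obtain ⟨n, hn⟩ := exists_int_of_qn_eq_zero (by omega) h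
      exact hα (n * r) (by rw [hn]; push_cast; rfl)
    · obtain ⟨n, hn⟩ := exists_int_of_qn_eq_zero (by omega) h
      rw [mul_comm] at hn
      exact hα n (mul_right_cancel₀ hr0 hn)
  · intro P hP φ hφ
    obtain ⟨W, p, i, hi⟩ : ∃ (W : WeightModule r) (p : tensorObj V W ⟶ P) (i : P ⟶ tensorObj V W),
      i ≫ p = 𝟙 P := ⟨_, _, exists_retract hP⟩
    have hVW := (hV.tensor W).projective
    have hψ : (toLin i ∘ₗ φ ∘ₗ toLin p) ∘ₗ (tensorObj V W).H =
        (tensorObj V W).H ∘ₗ (toLin i ∘ₗ φ ∘ₗ toLin p) :=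
      comp_comp_H (comp_comp_H (toLin_comp_H p) hφ) (toLin_comp_H i)
    have h1 : averageHom φ hφ = (averageHom φ hφ ≫ i) ≫ p := by
      rw [Category.assoc, hi, Category.comp_id]
    have h2 : p ≫ averageHom φ hφ ≫ i = averageHom (toLin i ∘ₗ φ ∘ₗ toLin p) hψ :=
      hom_ext (by
        rw [toLin_averageHom, average_comp, average_comp_right]; rfl)
    -- The partial trace of an average is the average of a partial trace, hence a scalar on `V` by
    -- `Valpha.average_eq`. Its quantum trace is that of `i φ p`, and `p i = 1` reduces this to the
    -- quantum trace of `φ`.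
    have h3 : ptrR V W (averageHom (toLin i ∘ₗ φ ∘ₗ toLin p) hψ) =
        (Valpha.scalar r (1 / 2) * quantumTrace P φ) • 𝟙 V :=
      hom_ext (by
        rw [toLin_ptrR, toLin_averageHom, ← average_partialTrace]
        rw [Valpha.average_eq (partialTrace_comp_H V W hψ), quantumTrace_partialTrace,
          quantumTrace_comp_comm, LinearMap.comp_assoc, ← toLin_comp, hi, toLin_id,
          LinearMap.comp_id]
        rfl)
    rw [h1, t.tr_comm _ _ hVW hP, h2, t.tr_tensor V W hV.projective hVW, h3, map_smul, hd,
      smul_eq_mul]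
    ring

end TraceFormula

/-! ### Adjoints of morphisms -/

section Dagger

variable {r : ℕ} {X Y Z : WeightModule r} (hX : HermitianStructure X) (hY : HermitianStructure Y)
  (hZ : HermitianStructure Z)

lemma adjoint_eq_of_form {f : X ⟶ Y} {g : Y ⟶ X}
    (h : ∀ w v, hY.form w (toLin f v) = hX.form (toLin g w) v) : adjoint hX hY f = g :=
  hom_ext (LinearMap.ext fun w => hX.form_injective fun v => by rw [← form_adjoint, h])

lemma adjoint_comp (f : X ⟶ Y) (g : Y ⟶ Z) :
    adjoint hX hZ (f ≫ g) = adjoint hY hZ g ≫ adjoint hX hY f :=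
  adjoint_eq_of_form hX hZ fun w v => by
    rw [toLin_comp, toLin_comp, LinearMap.comp_apply, LinearMap.comp_apply, form_adjoint hY hZ,
      form_adjoint hX hY]

lemma adjoint_adjoint (f : X ⟶ Y) : adjoint hY hX (adjoint hX hY f) = f :=
  adjoint_eq_of_form hY hX fun w v => by
    rw [hX.symm, ← form_adjoint hX hY, ← hY.symm]

lemma adjoint_eq_zero {f : X ⟶ Y} (h : adjoint hX hY f = 0) : f = 0 := by
  rw [← adjoint_adjoint hX hY f, h]
  exact adjoint_eq_of_form hY hX fun w v => by
    change hX.form w 0 = hY.form 0 v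
    rw [map_zero, map_zero, LinearMap.zero_apply]

end Dagger

/-! ### Reality and non-degeneracy of the modified trace -/

namespace ModifiedTrace

variable {r : ℕ} [r.AtLeastTwo] (t : ModifiedTrace r) {d₀ : ℝ}

lemma tr_adjoint (ht : t.IsNormalized d₀) {W : WeightModule r} (hW : Projective W) (h : HermitianStructure W)
    (f : W ⟶ W) : t.tr W hW (adjoint h h f) = conj (t.tr W hW f) := by
  obtain ⟨c, hc, -, htr⟩ := t.exists_tr_averageHom ht
  obtain ⟨φ, hφ, rfl⟩ := (IsAveraged.of_projective hW).exists_averageHom f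
  have hHK : Commute W.H (W.K ^ (r - 1 + (r - 1))) :=
    Commute.pow_right (show Commute W.H W.K from W.H_K) _
  have hψ := comp_comp_H (X := W) (Y := W) (Z := W) hHK.eq.symm (h.adj_comp_H hφ)
  have hadj : adjoint h h (averageHom φ hφ) =
      averageHom (h.adj φ * W.K ^ (r - 1 + (r - 1))) hψ := hom_ext (adj_average h hφ)
  rw [hadj, htr, htr, quantumTrace_adj, map_mul, hc]

/-- The pairing `Hom(W, V) × Hom(V, W) → ℂ` given by the modified trace is non-degenerate. -/
lemma eq_zero_of_tr_comp_left (ht : t.IsNormalized d₀) {V W : WeightModule r} (hV : Projective V) (hd : d₀ ≠ 0)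
    {f : W ⟶ V} (hf : ∀ g : V ⟶ W, t.tr V hV (g ≫ f) = 0) : f = 0 := by
  obtain ⟨c, -, hc, htr⟩ := t.exists_tr_averageHom ht
  by_contra hne
  obtain ⟨φ, hφ, hq⟩ := exists_quantumTrace_ne_zero hne
  have hψ := comp_comp_H hφ (toLin_comp_H f)
  -- The morphism that pairs nontrivially with `f` is the average of `φ`; this needs only that the
  -- object carrying the trace is projective, since the composite is itself an average.
  have h1 : averageHom φ hφ ≫ f = averageHom (toLin f ∘ₗ φ) hψ :=
    hom_ext (average_comp f φ).symm
  have h2 := hf (averageHom φ hφ)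
  rw [h1, htr] at h2
  exact mul_ne_zero (hc hd) hq h2

lemma eq_zero_of_tr_comp_right (ht : t.IsNormalized d₀) {V W : WeightModule r} (hW : Projective W) (hd : d₀ ≠ 0)
    {f : W ⟶ V} (hf : ∀ g : V ⟶ W, t.tr W hW (f ≫ g) = 0) : f = 0 := by
  obtain ⟨c, -, hc, htr⟩ := t.exists_tr_averageHom ht
  by_contra hne
  obtain ⟨φ, hφ, hq⟩ := exists_quantumTrace_ne_zero hne
  have hψ := comp_comp_H (toLin_comp_H f) hφ
  have h1 : f ≫ averageHom φ hφ = averageHom (φ ∘ₗ toLin f) hψ :=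
    hom_ext (average_comp_right f φ).symm
  have h2 := hf (averageHom φ hφ)
  rw [h1, htr, ← quantumTrace_comp_comm] at h2
  exact mul_ne_zero (hc hd) hq h2

end ModifiedTrace

end UnrolledQuantum

theorem mainTheorem11 (r : ℕ) [r.AtLeastTwo] (d₀ : ℝ) (t : ModifiedTrace r)
    (ht : t.IsNormalized d₀) :
    -- `t_W(f†)` is the complex conjugate of `t_W(f)`
    (∀ (W : HermitianObj r) (hW : Projective W.obj) (f : W.obj ⟶ W.obj),
      t.tr W.obj hW (HermitianObj.dagger f) = (starRingEnd ℂ) (t.tr W.obj hW f)) ∧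
    -- the pairing `(f, g) ↦ t_V(f† g) = t_W(g f†)` on `Hom(V, W)`
    (∀ V W : HermitianObj r,
      (∀ (hV : Projective V.obj) (hW : Projective W.obj) (f g : V.obj ⟶ W.obj),
        t.tr V.obj hV (g ≫ HermitianObj.dagger f) = t.tr W.obj hW (HermitianObj.dagger f ≫ g)) ∧
      (∀ hV : Projective V.obj,
        IsHermitianPairing (fun f g : V.obj ⟶ W.obj =>
          t.tr V.obj hV (g ≫ HermitianObj.dagger f)) ∧
        (d₀ ≠ 0 → IsNondegeneratePairing (fun f g : V.obj ⟶ W.obj =>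
          t.tr V.obj hV (g ≫ HermitianObj.dagger f)))) ∧
      (∀ hW : Projective W.obj,
        IsHermitianPairing (fun f g : V.obj ⟶ W.obj =>
          t.tr W.obj hW (HermitianObj.dagger f ≫ g)) ∧
        (d₀ ≠ 0 → IsNondegeneratePairing (fun f g : V.obj ⟶ W.obj =>
          t.tr W.obj hW (HermitianObj.dagger f ≫ g))))) := by
  refine ⟨fun W hW f => t.tr_adjoint ht hW W.herm f, fun V W => ⟨fun hV hW f g => ?_,
    fun hV => ⟨⟨fun f g g' => ?_, fun c f g => ?_, fun f g => ?_⟩, fun hd f hf => ?_⟩,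
    fun hW => ⟨⟨fun f g g' => ?_, fun c f g => ?_, fun f g => ?_⟩, fun hd f hf => ?_⟩⟩⟩
  · exact t.tr_comm _ _ hW hV g (HermitianObj.dagger f)
  · simp only [Preadditive.add_comp, map_add]
  · simp only [Linear.smul_comp, map_smul, smul_eq_mul]
  · simp only [HermitianObj.dagger]
    -- Conjugate symmetry is reality of the trace applied to `g† f`, whose adjoint is `f† g`.
    rw [← t.tr_adjoint ht hV V.herm, adjoint_comp V.herm W.herm V.herm, adjoint_adjoint]
  -- Non-degeneracy of the trace pairing gives `f† = 0`, and the adjoint is an involution.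
  · exact adjoint_eq_zero V.herm W.herm (t.eq_zero_of_tr_comp_left ht hV hd hf)
  · simp only [Preadditive.comp_add, map_add]
  · simp only [Linear.comp_smul, map_smul, smul_eq_mul]
  · simp only [HermitianObj.dagger]
    rw [← t.tr_adjoint ht hW W.herm, adjoint_comp W.herm V.herm W.herm, adjoint_adjoint]
  · exact adjoint_eq_zero V.herm W.herm (t.eq_zero_of_tr_comp_right ht hW hd hf)
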